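/- Proposition 1. Let $\Omega\subset\mathbb R^2$ be a bounded open set with Lipschitz boundary, $g\in L^2(\Omega)$ and $\alpha_1,\alpha_2\ge 0$. There is a constant $c\ge 0$, depending only on $\Omega,g,\alpha_1,\alpha_2$, for which the following holds. Continuous problem. Let $m\in\mathbb N$, let $T:L^2(\Omega)^m\to L^2(\Omega)$ be linear and bounded, $\beta\ge 0$, $\lambda>0$, $r,s\in[1,\infty]$ with $r^{-1}+s^{-1}=1$, and let $S=\mathrm{Id}$ or $S=\nabla$, where $\|S\mathbf v\|_{V_S}$ is the $L^2$-norm of $S\mathbf v$. For $\mathbf v\in H^1(\Omega)^m$ let $$E(\mathbf v)=\alpha_1\|T\mathbf v-g\|_{L^1(\Omega)}+\tfrac{\alpha_2}2\|T\mathbf v-g\|_{L^2(\Omega)}^2+\tfrac\beta2\|S\mathbf v\|_{V_S}^2+\lambda\int_\Omega|\nabla\mathbf v|_{F,r}\,dx,\qquad |w|_{F,r}=\Big(\sum_{n=1}^m\sum_{k=1}^2|w_{nk}|^r\Big)^{1/r}$$ (a maximum if $r=\infty$). For $\mathbf v\in L^2(\Omega)^m\setminus H^1(\Omega)^m$ let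 $E(\mathbf v)\in(-\infty,\infty]$ be given by the same formula, where $\int_\Omega|\nabla\mathbf v|_{F,r}\,dx$ stands for the total variation $\sup\{\int_\Omega\mathbf v\cdot\operatorname{div}\varphi\,dx:\varphi\in C_c^\infty(\Omega;(\mathbb R^2)^m),\ |\varphi|_{F,s}\le 1\}$ and $\|\nabla\mathbf v\|=\infty$ (with $0\cdot\infty=0$). Let $B=\alpha_2T^*T+\beta S^*S$ and $\|\mathbf v\|_B^2=\alpha_2\|T\mathbf v\|^2_{L^2(\Omega)}+\beta\|S\mathbf v\|_{V_S}^2$. Assume that $B$ is invertible, as an operator from $V$ to $V^*$, where $V=L^2(\Omega)^m$ if $S=\mathrm{Id}$ or $\beta=0$, and $V=H^1(\Omega)^m$ if $S=\nabla$ and $\beta>0$. For $\ell\in(H^1(\Omega)^m)^*$ let $\|\ell\|_{B^{-1}}^2=\langle\ell,B^{-1}\ell\rangle$ if $\ell$ extends to an element of $V^*$, and $\|\ell\|_{B^{-1}}^2=\infty$ otherwise. Here $\nabla^*:(L^2(\Omega)^2)^m\to(H^1(\Omega)^m)^*$ is the adjoint of $\nabla$. Let $\mathbf u$ minimize $E$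 over $H^1(\Omega)^m$. Discrete problem. Let $\Omega$ be triangulated by axis-parallel squares $E_1,\dots,E_N$ with side lengths $h_1,\dots,h_N$ (pairwise disjoint open squares in $\Omega$ whose closures cover $\Omega$; in particular any quad-tree grid). Let $I_h$ be the piecewise constant interpolation and $(g_h)_i=h_i^{-2}\int_{E_i}g\,dx$. Discrete functions are multiplied by $\langle v_h,w_h\rangle_{L^2(\Omega_h)}=\sum_ih_i^2(v_h)_i\cdot(w_h)_i$. Let $T_h,\nabla_h,T_h^*,\nabla_h^*,B_h^{-1}$ be any matrices of sizes $N\times mN$, $2mN\times mN$, $mN\times N$, $mN\times 2mN$, $mN\times mN$ (discretizations of $T,\nabla,T^*,\nabla^*,B^{-1}$; no relation between them is assumed), let $S_h=\mathrm{Id}$ if $S=\mathrm{Id}$ and $S_h=\nabla_h$ if $S=\nabla$, and let $\|w_h\|^2_{B_h^{-1}}=\langle w_h,B_h^{-1}w_h\rangle_{L^2(\Omega_h)}$. Let $$E_h(\mathbf v_h)=\alpha_1\sum_ih_i^2|(T_h\mathbf v_h-g_h)_i|+\tfrac{\alpha_2}2\|T_h\mathbf v_h-g_h\|^2_{L^2(\Omega_h)}+\tfrac\beta2\|S_h\mathbf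 v_h\|^2_{L^2(\Omega_h)}+\lambda\sum_ih_i^2|(\nabla_h\mathbf v_h)_i|_{F,r},$$ $$D_h(q_{h,1},\mathbf q_{h,2})=-\tfrac12\|T_h^*q_{h,1}+\nabla_h^*\mathbf q_{h,2}-\alpha_2T_h^*g_h\|^2_{B_h^{-1}}+\tfrac{\alpha_2}2\|g_h\|^2_{L^2(\Omega_h)}-\langle g_h,q_{h,1}\rangle_{L^2(\Omega_h)}$$ if $|(q_{h,1})_i|\le\alpha_1$ and $|(\mathbf q_{h,2})_i|_{F,s}\le\lambda$ for all $i$, and $D_h(q_{h,1},\mathbf q_{h,2})=-\infty$ otherwise. Let $\mathbf u_h$ minimize $E_h$ over $\mathbb R^{mN}$ and let $(p_{h,1},\mathbf p_{h,2})$ maximize $D_h$ over $\mathbb R^N\times\mathbb R^{2mN}$. Then for all $\mathbf v_h\in\mathbb R^{mN}$ and $(q_{h,1},\mathbf q_{h,2})\in\mathbb R^N\times\mathbb R^{2mN}$, $$\tfrac12\|I_h\mathbf u_h-\mathbf u\|_B^2\le\eta_h(\mathbf v_h,q_{h,1},\mathbf q_{h,2})+c\,\|I_hg_h-g\|_{L^2(\Omega)}+R_h(\mathbf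 u_h)+Q_h(p_{h,1},\mathbf p_{h,2})$$ as an inequality in $[-\infty,\infty]$, where $$\eta_h(\mathbf v_h,q_{h,1},\mathbf q_{h,2})=E_h(\mathbf v_h)-D_h(q_{h,1},\mathbf q_{h,2}),\qquad R_h(\mathbf u_h)=E(I_h\mathbf u_h)-E_h(\mathbf u_h),$$ $$Q_h(p_{h,1},\mathbf p_{h,2})=\tfrac12\Big(\|T^*I_hp_{h,1}+\nabla^*I_h\mathbf p_{h,2}-\alpha_2T^*g\|^2_{B^{-1}}-\|T_h^*p_{h,1}+\nabla_h^*\mathbf p_{h,2}-\alpha_2T_h^*g_h\|^2_{B_h^{-1}}\Big).$$ -/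

import Mathlib

open MeasureTheory
open scoped ENNReal ContDiff RealInnerProductSpace

noncomputable section

namespace PDGap

/-! ## Function spaces on a planar domain -/

/-- The plane `ℝ²` with the Euclidean norm. -/
abbrev Pt : Type := EuclideanSpace ℝ (Fin 2)

/-- `ℝᵐ`, the values of an image with `m` channels. -/
abbrev Vec (m : ℕ) : Type := EuclideanSpace ℝ (Fin m)

/-- `(ℝ²)ᵐ`, the values of a gradient; the entry `(n, k)` belongs to channel `n`, direction `k`. -/
abbrev Mat (m : ℕ) : Type := EuclideanSpace ℝ (Fin m × Fin 2)

/-- `L²(Ω; F)` for Lebesgue measure on `Ω`. For `F = ℝ`, `Vec m`, `Mat m` this is `L²(Ω)`,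
`L²(Ω)ᵐ`, `(L²(Ω)²)ᵐ` with the inner product that sums the inner products of the components. -/
abbrev L2 (Ω : Set Pt) (F : Type) [NormedAddCommGroup F] : Type :=
  Lp F 2 (volume.restrict Ω)

/-- Near each boundary point, after a linear isometric change of coordinates, `Ω` is the set of
points above the graph of a Lipschitz function. -/
def HasLipschitzBoundary (Ω : Set Pt) : Prop :=
  ∀ x ∈ frontier Ω, ∃ (Φ : Pt ≃ₗᵢ[ℝ] Pt) (γ : ℝ → ℝ) (K : NNReal) (δ : ℝ),
    0 < δ ∧ LipschitzWith K γ ∧ ∀ y ∈ Metric.ball x δ, (y ∈ Ω ↔ γ (Φ y 0) < Φ y 1)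

/-- Smooth functions on the plane with compact support inside `Ω`. -/
def IsTest {F : Type} [NormedAddCommGroup F] [NormedSpace ℝ F] (Ω : Set Pt) (φ : Pt → F) : Prop :=
  ContDiff ℝ ∞ φ ∧ HasCompactSupport φ ∧ tsupport φ ⊆ Ω

/-- The partial derivative `∂_k φ (x)` of a differentiable function. -/
def pd {F : Type} [NormedAddCommGroup F] [NormedSpace ℝ F] (k : Fin 2) (φ : Pt → F) (x : Pt) : F :=
  fderiv ℝ φ x (EuclideanSpace.single k 1)

/-- `G` is the weak gradient of `v` on `Ω`. -/
def IsWeakGradient (Ω : Set Pt) {m : ℕ} (v : L2 Ω (Vec m)) (G : L2 Ω (Mat m)) : Prop :=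
  ∀ φ : Pt → ℝ, IsTest Ω φ → ∀ (n : Fin m) (k : Fin 2),
    ∫ x in Ω, v x n * pd k φ x = - ∫ x in Ω, G x (n, k) * φ x

theorem integrable_coord_mul {Ω : Set Pt} {ι : Type} [Fintype ι] (f : L2 Ω (EuclideanSpace ℝ ι))
    (i : ι) {ψ : Pt → ℝ} (hc : Continuous ψ) (hs : HasCompactSupport ψ) :
    Integrable (fun x => f x i * ψ x) (volume.restrict Ω) := by
  have h1 : MemLp (fun x => f x i) 2 (volume.restrict Ω) :=
    (EuclideanSpace.proj i : EuclideanSpace ℝ ι →L[ℝ] ℝ).comp_memLp' (Lp.memLp f)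
  have h2 : MemLp ψ 2 (volume.restrict Ω) := hc.memLp_of_hasCompactSupport hs
  exact h1.integrable_mul h2

theorem IsTest.continuous_pd {Ω : Set Pt} {φ : Pt → ℝ} (h : IsTest Ω φ) (k : Fin 2) :
    Continuous (pd k φ) :=
  (h.1.continuous_fderiv (by simp)).clm_apply continuous_const

theorem IsTest.hasCompactSupport_pd {Ω : Set Pt} {φ : Pt → ℝ} (h : IsTest Ω φ) (k : Fin 2) :
    HasCompactSupport (pd k φ) :=
  h.2.1.fderiv_apply ℝ _

/-- The Sobolev space `H¹(Ω)ᵐ`, as the Hilbert space of all pairs `(v, ∇v)` with `v ∈ L²(Ω)ᵐ` whose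
weak gradient is in `(L²(Ω)²)ᵐ`; its norm is `(‖v‖² + ‖∇v‖²)^(1/2)`. -/
def H1 (Ω : Set Pt) (m : ℕ) : Submodule ℝ (WithLp 2 (L2 Ω (Vec m) × L2 Ω (Mat m))) where
  carrier := {w | IsWeakGradient Ω w.fst w.snd}
  zero_mem' := by
    intro φ _ n k
    have e1 : ∀ᵐ x ∂(volume.restrict Ω), (0 : L2 Ω (Vec m)) x n * pd k φ x = 0 := by
      filter_upwards [Lp.coeFn_zero (Vec m) 2 (volume.restrict Ω)] with x hx
      rw [hx]; simp
    have e2 : ∀ᵐ x ∂(volume.restrict Ω), (0 : L2 Ω (Mat m)) x (n, k) * φ x = 0 := by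
      filter_upwards [Lp.coeFn_zero (Mat m) 2 (volume.restrict Ω)] with x hx
      rw [hx]; simp
    change ∫ x in Ω, (0 : L2 Ω (Vec m)) x n * pd k φ x
      = - ∫ x in Ω, (0 : L2 Ω (Mat m)) x (n, k) * φ x
    rw [integral_congr_ae e1, integral_congr_ae e2]
    simp
  add_mem' := by
    intro a b ha hb φ hφ n k
    have e1 : ∀ᵐ x ∂(volume.restrict Ω), (a.fst + b.fst : L2 Ω (Vec m)) x n * pd k φ x
        = a.fst x n * pd k φ x + b.fst x n * pd k φ x := by
      filter_upwards [Lp.coeFn_add a.fst b.fst] with x hx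
      rw [hx]; simp only [Pi.add_apply, PiLp.add_apply, add_mul]
    have e2 : ∀ᵐ x ∂(volume.restrict Ω), (a.snd + b.snd : L2 Ω (Mat m)) x (n, k) * φ x
        = a.snd x (n, k) * φ x + b.snd x (n, k) * φ x := by
      filter_upwards [Lp.coeFn_add a.snd b.snd] with x hx
      rw [hx]; simp only [Pi.add_apply, PiLp.add_apply, add_mul]
    change ∫ x in Ω, (a.fst + b.fst : L2 Ω (Vec m)) x n * pd k φ x
      = - ∫ x in Ω, (a.snd + b.snd : L2 Ω (Mat m)) x (n, k) * φ x
    have hp := hφ.continuous_pd k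
    have hps := hφ.hasCompactSupport_pd k
    rw [integral_congr_ae e1, integral_congr_ae e2,
      integral_add (integrable_coord_mul _ n hp hps) (integrable_coord_mul _ n hp hps),
      integral_add (integrable_coord_mul _ (n, k) hφ.1.continuous hφ.2.1)
        (integrable_coord_mul _ (n, k) hφ.1.continuous hφ.2.1), ha φ hφ n k, hb φ hφ n k]
    ring
  smul_mem' := by
    intro c a ha φ hφ n k
    have e1 : ∀ᵐ x ∂(volume.restrict Ω), (c • a.fst : L2 Ω (Vec m)) x n * pd k φ x
        = c * (a.fst x n * pd k φ x) := by
      filter_upwards [Lp.coeFn_smul c a.fst] with x hx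
      rw [hx]; simp only [Pi.smul_apply, PiLp.smul_apply, smul_eq_mul, mul_assoc]
    have e2 : ∀ᵐ x ∂(volume.restrict Ω), (c • a.snd : L2 Ω (Mat m)) x (n, k) * φ x
        = c * (a.snd x (n, k) * φ x) := by
      filter_upwards [Lp.coeFn_smul c a.snd] with x hx
      rw [hx]; simp only [Pi.smul_apply, PiLp.smul_apply, smul_eq_mul, mul_assoc]
    change ∫ x in Ω, (c • a.fst : L2 Ω (Vec m)) x n * pd k φ x
      = - ∫ x in Ω, (c • a.snd : L2 Ω (Mat m)) x (n, k) * φ x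
    rw [integral_congr_ae e1, integral_congr_ae e2, integral_const_mul, integral_const_mul,
      ha φ hφ n k]
    ring

/-- The embedding `H¹(Ω)ᵐ → L²(Ω)ᵐ`. -/
def incl (Ω : Set Pt) (m : ℕ) : H1 Ω m →L[ℝ] L2 Ω (Vec m) :=
  (WithLp.fstL 2 ℝ (L2 Ω (Vec m)) (L2 Ω (Mat m))) ∘L (H1 Ω m).subtypeL

/-- The gradient `∇ : H¹(Ω)ᵐ → (L²(Ω)²)ᵐ`. -/
def grad (Ω : Set Pt) (m : ℕ) : H1 Ω m →L[ℝ] L2 Ω (Mat m) :=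
  (WithLp.sndL 2 ℝ (L2 Ω (Vec m)) (L2 Ω (Mat m))) ∘L (H1 Ω m).subtypeL

/-- The Frobenius norm `|w|_{F,p} = (∑ |w_{nk}|ᵖ)^(1/p)`; the maximum of the `|w_{nk}|` if
`p = ∞`. -/
def frob {m : ℕ} (p : ℝ≥0∞) (w : Mat m) : ℝ :=
  ‖(WithLp.toLp p (fun j => w j) : PiLp p (fun _ : Fin m × Fin 2 => ℝ))‖

/-- The total variation `∫_Ω |Dv|_{F,r}` in `[0, ∞]`, where `s` is the exponent conjugate to `r`, so
that `|·|_{F,s}` is the norm dual to `|·|_{F,r}`. -/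
def totalVariation {Ω : Set Pt} {m : ℕ} (s : ℝ≥0∞) (v : L2 Ω (Vec m)) : ℝ≥0∞ :=
  ⨆ (φ : Pt → Mat m) (_ : IsTest Ω φ ∧ ∀ x, frob s (φ x) ≤ 1),
    ENNReal.ofReal (∫ x in Ω, ∑ n, v x n * ∑ k, pd k φ x (n, k))

/-! ## The continuous problem -/

/-- The two choices `S = Id` and `S = ∇`. -/
inductive Reg : Type
  | id
  | grad

/-- `‖S w‖²_{V_S}` for `w ∈ H¹(Ω)ᵐ`. -/
def sNormSq {Ω : Set Pt} {m : ℕ} : Reg → H1 Ω m → ℝ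
  | .id, w => ‖incl Ω m w‖ ^ 2
  | .grad, w => ‖grad Ω m w‖ ^ 2

/-- The energy `E` of the primal problem on `H¹(Ω)ᵐ`. -/
def primalEnergy {Ω : Set Pt} {m : ℕ} (g : L2 Ω ℝ) (α₁ α₂ β lam : ℝ) (r : ℝ≥0∞)
    (T : L2 Ω (Vec m) →L[ℝ] L2 Ω ℝ) (S : Reg) (w : H1 Ω m) : ℝ :=
  α₁ * (∫ x in Ω, |(T (incl Ω m w) - g : L2 Ω ℝ) x|) + α₂ / 2 * ‖T (incl Ω m w) - g‖ ^ 2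
    + β / 2 * sNormSq S w + lam * ∫ x in Ω, frob r (grad Ω m w x)

/-- `u` solves the primal problem. -/
def IsPrimalSolution {Ω : Set Pt} {m : ℕ} (g : L2 Ω ℝ) (α₁ α₂ β lam : ℝ) (r : ℝ≥0∞)
    (T : L2 Ω (Vec m) →L[ℝ] L2 Ω ℝ) (S : Reg) (u : H1 Ω m) : Prop :=
  ∀ w : H1 Ω m,
    primalEnergy g α₁ α₂ β lam r T S u ≤ primalEnergy g α₁ α₂ β lam r T S w

open Classical in
/-- `‖S v‖²_{V_S}` for `v ∈ L²(Ω)ᵐ`; for `S = ∇` it is `∞` off `H¹(Ω)ᵐ`. -/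
def sNormSqExt {Ω : Set Pt} {m : ℕ} : Reg → L2 Ω (Vec m) → ℝ≥0∞
  | .id, v => ENNReal.ofReal (‖v‖ ^ 2)
  | .grad, v => if h : ∃ w : H1 Ω m, incl Ω m w = v then
      ENNReal.ofReal (‖grad Ω m h.choose‖ ^ 2) else ⊤

open Classical in
/-- The energy `E` on `L²(Ω)ᵐ`: the one of the primal problem on `H¹(Ω)ᵐ`; off `H¹(Ω)ᵐ` (as for most
piecewise constant functions) the integral of `|∇v|_{F,r}` is the total variation of `v`.
The element of `H¹(Ω)ᵐ` that is chosen is unique, since weak gradients are. In `[0, ∞]`,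
`0 * ∞ = 0`. -/
def extEnergy {Ω : Set Pt} {m : ℕ} (g : L2 Ω ℝ) (α₁ α₂ β lam : ℝ) (r s : ℝ≥0∞)
    (T : L2 Ω (Vec m) →L[ℝ] L2 Ω ℝ) (S : Reg) (v : L2 Ω (Vec m)) : EReal :=
  if h : ∃ w : H1 Ω m, incl Ω m w = v then
    ((primalEnergy g α₁ α₂ β lam r T S h.choose : ℝ) : EReal)
  else
    ((α₁ * (∫ x in Ω, |(T v - g : L2 Ω ℝ) x|) + α₂ / 2 * ‖T v - g‖ ^ 2 : ℝ) : EReal)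
      + ((ENNReal.ofReal (β / 2) * sNormSqExt S v
        + ENNReal.ofReal lam * totalVariation s v : ℝ≥0∞) : EReal)

/-- `‖v‖²_B = α₂ ‖T v‖² + β ‖S v‖²`. -/
def bNormSq {Ω : Set Pt} {m : ℕ} (α₂ β : ℝ) (T : L2 Ω (Vec m) →L[ℝ] L2 Ω ℝ) (S : Reg)
    (v : L2 Ω (Vec m)) : EReal :=
  ((α₂ * ‖T v‖ ^ 2 : ℝ) : EReal) + ((ENNReal.ofReal β * sNormSqExt S v : ℝ≥0∞) : EReal)

/-- The operator `α₂ A* A + β Σ* Σ : V → V*`. -/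
def normalOp {Ω : Set Pt} {V W : Type} [NormedAddCommGroup V] [InnerProductSpace ℝ V]
    [NormedAddCommGroup W] [InnerProductSpace ℝ W] (α₂ β : ℝ)
    (A : V →L[ℝ] L2 Ω ℝ) (Sg : V →L[ℝ] W) : V →L[ℝ] StrongDual ℝ V :=
  α₂ • (innerSL ℝ).bilinearComp A A + β • (innerSL ℝ).bilinearComp Sg Sg

/-- `B = α₂ T* T + β S* S` as an operator from `L²(Ω)ᵐ` to its dual, for `S = Id` or `β = 0`. -/
def opL2 {Ω : Set Pt} {m : ℕ} (α₂ β : ℝ) (T : L2 Ω (Vec m) →L[ℝ] L2 Ω ℝ) :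
    L2 Ω (Vec m) →L[ℝ] StrongDual ℝ (L2 Ω (Vec m)) :=
  normalOp α₂ β T (ContinuousLinearMap.id ℝ (L2 Ω (Vec m)))

/-- `B = α₂ T* T + β S* S` as an operator from `H¹(Ω)ᵐ` to its dual, for `S = ∇` and `β ≠ 0`. -/
def opH1 {Ω : Set Pt} {m : ℕ} (α₂ β : ℝ) (T : L2 Ω (Vec m) →L[ℝ] L2 Ω ℝ) :
    H1 Ω m →L[ℝ] StrongDual ℝ (H1 Ω m) :=
  normalOp α₂ β (T ∘L incl Ω m) (grad Ω m)

open Classical in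
/-- `B` is invertible, on `L²(Ω)ᵐ` if it is an operator of order zero and on `H¹(Ω)ᵐ` if it has the
part `β ∇* ∇`. -/
def BInvertible {Ω : Set Pt} {m : ℕ} (α₂ β : ℝ) (T : L2 Ω (Vec m) →L[ℝ] L2 Ω ℝ) (S : Reg) :
    Prop :=
  if S = .id ∨ β = 0 then (opL2 α₂ β T).IsInvertible else (opH1 α₂ β T).IsInvertible

/-- `⟨ℓ, B⁻¹ ℓ⟩` for a functional `ℓ` on `H¹(Ω)ᵐ` and `B : V → V*`, where `j` embeds `H¹(Ω)ᵐ` densely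
in `V`: if `ℓ` extends to a (then unique) element `f` of `V*`, the value is `⟨f, B⁻¹ f⟩`, else
`∞`. -/
def invSq {Ω : Set Pt} {m : ℕ} {V : Type} [NormedAddCommGroup V] [InnerProductSpace ℝ V]
    (B : V →L[ℝ] StrongDual ℝ V) (j : H1 Ω m →L[ℝ] V) (ℓ : StrongDual ℝ (H1 Ω m)) : EReal :=
  ⨅ (f : StrongDual ℝ V) (_ : f ∘L j = ℓ), ((f (B.inverse f) : ℝ) : EReal)

open Classical in
/-- `‖ℓ‖²_{B⁻¹} = ⟨ℓ, B⁻¹ ℓ⟩`. -/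
def bInvNormSq {Ω : Set Pt} {m : ℕ} (α₂ β : ℝ) (T : L2 Ω (Vec m) →L[ℝ] L2 Ω ℝ) (S : Reg)
    (ℓ : StrongDual ℝ (H1 Ω m)) : EReal :=
  if S = .id ∨ β = 0 then invSq (opL2 α₂ β T) (incl Ω m) ℓ
  else invSq (opH1 α₂ β T) (ContinuousLinearMap.id ℝ (H1 Ω m)) ℓ

/-- An element of `L²(Ω)ᵐ` as a functional on `H¹(Ω)ᵐ`. -/
def toDual {Ω : Set Pt} {m : ℕ} (f : L2 Ω (Vec m)) : StrongDual ℝ (H1 Ω m) :=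
  (innerSL ℝ f) ∘L incl Ω m

/-- The adjoint `∇*` of the gradient, with values in the dual of `H¹(Ω)ᵐ`. -/
def gradAdj {Ω : Set Pt} {m : ℕ} (q : L2 Ω (Mat m)) : StrongDual ℝ (H1 Ω m) :=
  (innerSL ℝ q) ∘L grad Ω m

/-- `T* p₁ + ∇* p₂ - α₂ T* g`. -/
def dualResidual {Ω : Set Pt} {m : ℕ} (g : L2 Ω ℝ) (α₂ : ℝ) (T : L2 Ω (Vec m) →L[ℝ] L2 Ω ℝ)
    (p₁ : L2 Ω ℝ) (p₂ : L2 Ω (Mat m)) : StrongDual ℝ (H1 Ω m) :=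
  toDual (ContinuousLinearMap.adjoint T p₁) + gradAdj p₂
    - α₂ • toDual (ContinuousLinearMap.adjoint T g)

/-! ## Grids of squares and the discrete problem -/

/-- The open axis-parallel square with center `x` and side length `h`. -/
def square (x : Pt) (h : ℝ) : Set Pt := {y | ∀ k, |y k - x k| < h / 2}

theorem isOpen_square (x : Pt) (h : ℝ) : IsOpen (square x h) := by
  have : square x h = ⋂ k, {y : Pt | |y k - x k| < h / 2} := by
    ext y; simp [square]
  rw [this]
  exact isOpen_iInter_of_finite fun k => isOpen_lt (by fun_prop) continuous_const

theorem isBounded_square (x : Pt) (h : ℝ) : Bornology.IsBounded (square x h) := by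
  refine (Metric.isBounded_closedBall (x := x) (r := Real.sqrt (∑ _k : Fin 2, (h / 2) ^ 2))).subset ?_
  intro y hy
  rw [Metric.mem_closedBall, EuclideanSpace.dist_eq]
  refine Real.sqrt_le_sqrt (Finset.sum_le_sum fun k _ => ?_)
  have hk := hy k
  rw [Real.dist_eq]
  gcongr

theorem volume_square_ne_top (Ω : Set Pt) (x : Pt) (h : ℝ) :
    volume.restrict Ω (square x h) ≠ ⊤ :=
  ((Measure.restrict_apply_le _ _).trans_lt (isBounded_square x h).measure_lt_top).ne

/-- A triangulation of `Ω` by `N` axis-parallel squares, of arbitrary sizes. -/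
structure SquareGrid (Ω : Set Pt) (N : ℕ) where
  center : Fin N → Pt
  side : Fin N → ℝ
  side_pos : ∀ i, 0 < side i
  subset : ∀ i, square (center i) (side i) ⊆ Ω
  disjoint : ∀ i j, i ≠ j → Disjoint (square (center i) (side i)) (square (center j) (side j))
  cover : Ω ⊆ ⋃ i, closure (square (center i) (side i))

/-- The `i`-th element of the grid. -/
def SquareGrid.cell {Ω : Set Pt} {N : ℕ} (G : SquareGrid Ω N) (i : Fin N) : Set Pt :=
  square (G.center i) (G.side i)

/-- The piecewise constant interpolation `I_h`. -/
def SquareGrid.interp {Ω : Set Pt} {N : ℕ} (G : SquareGrid Ω N) {F : Type} [NormedAddCommGroup F]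
    (v : Fin N → F) : L2 Ω F :=
  ∑ i, indicatorConstLp 2 (isOpen_square (G.center i) (G.side i)).measurableSet
    (volume_square_ne_top Ω (G.center i) (G.side i)) (v i)

/-- The discretization `g_h` of `g` by mean values over the elements. -/
def SquareGrid.discretize {Ω : Set Pt} {N : ℕ} (G : SquareGrid Ω N) (g : L2 Ω ℝ) : Fin N → ℝ :=
  fun i => (G.side i ^ 2)⁻¹ * ∫ x in G.cell i, g x

/-- The scalar products of `L²(Ω_h)`, `L²(Ω_h)ᵐ` and `(L²(Ω_h)²)ᵐ`. -/
def SquareGrid.inner {Ω : Set Pt} {N : ℕ} (G : SquareGrid Ω N) {F : Type} [NormedAddCommGroup F]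
    [InnerProductSpace ℝ F] (v w : Fin N → F) : ℝ :=
  ∑ i, G.side i ^ 2 * ⟪v i, w i⟫

/-- `‖S_h v_h‖²_{V_{S,h}}`, where `S_h = Id` if `S = Id` and `S_h = ∇_h` if `S = ∇`. -/
def sNormSqDisc {Ω : Set Pt} {N m : ℕ} (G : SquareGrid Ω N)
    (gradh : (Fin N → Vec m) →ₗ[ℝ] (Fin N → Mat m)) : Reg → (Fin N → Vec m) → ℝ
  | .id, v => G.inner v v
  | .grad, v => G.inner (gradh v) (gradh v)

/-- The discrete primal energy `E_h`. -/
def discEnergy {Ω : Set Pt} {N m : ℕ} (G : SquareGrid Ω N) (g : L2 Ω ℝ) (α₁ α₂ β lam : ℝ)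
    (r : ℝ≥0∞) (S : Reg) (Th : (Fin N → Vec m) →ₗ[ℝ] (Fin N → ℝ))
    (gradh : (Fin N → Vec m) →ₗ[ℝ] (Fin N → Mat m)) (v : Fin N → Vec m) : ℝ :=
  α₁ * ∑ i, G.side i ^ 2 * |(Th v - G.discretize g) i|
    + α₂ / 2 * G.inner (Th v - G.discretize g) (Th v - G.discretize g)
    + β / 2 * sNormSqDisc G gradh S v
    + lam * ∑ i, G.side i ^ 2 * frob r (gradh v i)

/-- `‖T_h* q₁ + ∇_h* q₂ - α₂ T_h* g_h‖²_{B_h⁻¹}`, where `‖w‖²_{B_h⁻¹} = ⟨w, B_h⁻¹ w⟩`. -/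
def discResidualSq {Ω : Set Pt} {N m : ℕ} (G : SquareGrid Ω N) (g : L2 Ω ℝ) (α₂ : ℝ)
    (Ths : (Fin N → ℝ) →ₗ[ℝ] (Fin N → Vec m))
    (gradhs : (Fin N → Mat m) →ₗ[ℝ] (Fin N → Vec m))
    (Bhi : (Fin N → Vec m) →ₗ[ℝ] (Fin N → Vec m))
    (q₁ : Fin N → ℝ) (q₂ : Fin N → Mat m) : ℝ :=
  G.inner (Ths q₁ + gradhs q₂ - α₂ • Ths (G.discretize g))
    (Bhi (Ths q₁ + gradhs q₂ - α₂ • Ths (G.discretize g)))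

open Classical in
/-- The discrete dual energy `D_h`, equal to `-∞` unless `|q₁| ≤ α₁` and `|q₂|_{F,s} ≤ λ` on all
elements. -/
def discDual {Ω : Set Pt} {N m : ℕ} (G : SquareGrid Ω N) (g : L2 Ω ℝ) (α₁ α₂ lam : ℝ)
    (s : ℝ≥0∞) (Ths : (Fin N → ℝ) →ₗ[ℝ] (Fin N → Vec m))
    (gradhs : (Fin N → Mat m) →ₗ[ℝ] (Fin N → Vec m))
    (Bhi : (Fin N → Vec m) →ₗ[ℝ] (Fin N → Vec m))
    (q₁ : Fin N → ℝ) (q₂ : Fin N → Mat m) : EReal :=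
  if (∀ i, |q₁ i| ≤ α₁) ∧ (∀ i, frob s (q₂ i) ≤ lam) then
    ((-(1 / 2) * discResidualSq G g α₂ Ths gradhs Bhi q₁ q₂
      + α₂ / 2 * G.inner (G.discretize g) (G.discretize g)
      - G.inner (G.discretize g) q₁ : ℝ) : EReal)
  else ⊥

/-- The discrete primal-dual gap `η_h`. -/
def gapError {Ω : Set Pt} {N m : ℕ} (G : SquareGrid Ω N) (g : L2 Ω ℝ) (α₁ α₂ β lam : ℝ)
    (r s : ℝ≥0∞) (S : Reg) (Th : (Fin N → Vec m) →ₗ[ℝ] (Fin N → ℝ))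
    (Ths : (Fin N → ℝ) →ₗ[ℝ] (Fin N → Vec m))
    (gradh : (Fin N → Vec m) →ₗ[ℝ] (Fin N → Mat m))
    (gradhs : (Fin N → Mat m) →ₗ[ℝ] (Fin N → Vec m))
    (Bhi : (Fin N → Vec m) →ₗ[ℝ] (Fin N → Vec m))
    (v : Fin N → Vec m) (q₁ : Fin N → ℝ) (q₂ : Fin N → Mat m) : EReal :=
  ((discEnergy G g α₁ α₂ β lam r S Th gradh v : ℝ) : EReal)
    - discDual G g α₁ α₂ lam s Ths gradhs Bhi q₁ q₂

/-- The primal consistency term `R_h`. -/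
def primalConsistency {Ω : Set Pt} {N m : ℕ} (G : SquareGrid Ω N) (g : L2 Ω ℝ)
    (α₁ α₂ β lam : ℝ) (r s : ℝ≥0∞) (T : L2 Ω (Vec m) →L[ℝ] L2 Ω ℝ) (S : Reg)
    (Th : (Fin N → Vec m) →ₗ[ℝ] (Fin N → ℝ))
    (gradh : (Fin N → Vec m) →ₗ[ℝ] (Fin N → Mat m)) (v : Fin N → Vec m) : EReal :=
  extEnergy g α₁ α₂ β lam r s T S (G.interp v)
    - ((discEnergy G g α₁ α₂ β lam r S Th gradh v : ℝ) : EReal)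

/-- The dual consistency term `Q_h`. -/
def dualConsistency {Ω : Set Pt} {N m : ℕ} (G : SquareGrid Ω N) (g : L2 Ω ℝ) (α₂ β : ℝ)
    (T : L2 Ω (Vec m) →L[ℝ] L2 Ω ℝ) (S : Reg)
    (Ths : (Fin N → ℝ) →ₗ[ℝ] (Fin N → Vec m))
    (gradhs : (Fin N → Mat m) →ₗ[ℝ] (Fin N → Vec m))
    (Bhi : (Fin N → Vec m) →ₗ[ℝ] (Fin N → Vec m))
    (p₁ : Fin N → ℝ) (p₂ : Fin N → Mat m) : EReal :=
  ((1 / 2 : ℝ) : EReal) *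
    (bInvNormSq α₂ β T S (dualResidual g α₂ T (G.interp p₁) (G.interp p₂))
      - ((discResidualSq G g α₂ Ths gradhs Bhi p₁ p₂ : ℝ) : EReal))

end PDGap

end

open PDGap

/-! The energy is convex, and its quadratic terms have exactly the curvature of `‖·‖²_B`. Hence its
growth from the minimizer satisfies `½‖w - u‖²_B ≤ E(w) - E(u)`. Weak duality bounds `E(u)` from
below by the continuous dual energy at `I_h p_h`, which is feasible because `p_h` is. With `w = I_h
u_h`, the definitions of `R_h` and `Q_h` turn this into the bound `E_h(u_h) - D_h(p_h) + R_h + Q_h +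
(α₂/2)(‖g_h‖² - ‖g‖²)`. Mean values give `⟨g, I_h p⟩ = ⟨g_h, p⟩` and `‖g_h‖ ≤ ‖g‖`, so the data term
can be dropped and `c = 0` works. Optimality of `u_h` and `p_h` replaces the remaining discrete gap
by `η_h` at arbitrary arguments. Neither strong duality nor any relation between the discrete
operators enters.

The hard point is that `I_h u_h` is usually only of bounded variation, while `u` is minimal only in
`H¹`. The growth inequality passes to such functions through `exists_H1_approx`: they are `L²`
limits of `H¹` functions with asymptotically no larger variation. Each piece `ζ i * v` of a
partition of unity is extended by zero, translated so that values are taken further inside `Ω`, and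
mollified. The sum is smooth on the whole plane, hence in `H¹` of the bounded domain. Tested against
`φ`, its gradient becomes `v` tested against `∑ ζ i • moll ρ (-b i) φ`, up to a commutator. The
Lipschitz boundary makes the latter field admissible, and the commutator vanishes in the limit
because the derivatives of the `ζ i` cancel. By `integral_frob_le_of_forall_isTest`, bounds on such
pairings bound the integral of `|∇w|_{F,r}`.

Weak duality combines Hölder's inequality for the constrained dual variables with the Fenchel
inequality for the form of `B`, `normalOp_inverse_le`. -/

noncomputable section

namespace PDGap

/-! ## The Frobenius norms -/

section Frob

variable {m : ℕ}

/-- The identity as a linear map onto `ℝ^{m × 2}` with the `p`-norm. -/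
def frobMap (m : ℕ) (p : ℝ≥0∞) [Fact (1 ≤ p)] :
    Mat m →L[ℝ] PiLp p (fun _ : Fin m × Fin 2 => ℝ) :=
  LinearMap.toContinuousLinearMap
    ((WithLp.linearEquiv 2 ℝ (Fin m × Fin 2 → ℝ)).trans
      (WithLp.linearEquiv p ℝ (Fin m × Fin 2 → ℝ)).symm).toLinearMap

variable {p r s : ℝ≥0∞}

theorem frob_eq_norm [Fact (1 ≤ p)] (w : Mat m) : frob p w = ‖frobMap m p w‖ := rfl

theorem frob_nonneg [Fact (1 ≤ p)] (w : Mat m) : 0 ≤ frob p w := norm_nonneg _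

theorem frob_zero [Fact (1 ≤ p)] : frob p (0 : Mat m) = 0 := by
  rw [frob_eq_norm, map_zero, norm_zero]

theorem frob_add_le [Fact (1 ≤ p)] (v w : Mat m) : frob p (v + w) ≤ frob p v + frob p w := by
  simp only [frob_eq_norm, map_add]; exact norm_add_le _ _

theorem frob_smul [Fact (1 ≤ p)] (c : ℝ) (w : Mat m) : frob p (c • w) = |c| * frob p w := by
  simp only [frob_eq_norm, map_smul, norm_smul, Real.norm_eq_abs]

theorem frob_neg [Fact (1 ≤ p)] (w : Mat m) : frob p (-w) = frob p w := by
  simp only [frob_eq_norm, map_neg, norm_neg]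

theorem continuous_frob [Fact (1 ≤ p)] : Continuous (frob p : Mat m → ℝ) :=
  (frobMap m p).continuous.norm

theorem abs_apply_le_frob [Fact (1 ≤ p)] (w : Mat m) (j : Fin m × Fin 2) : |w j| ≤ frob p w :=
  PiLp.norm_apply_le (p := p) (frobMap m p w) j

theorem norm_le_of_frob_le_one [Fact (1 ≤ s)] {w : Mat m} (hw : frob s w ≤ 1) :
    ‖w‖ ≤ Real.sqrt (∑ _j : Fin m × Fin 2, 1) := by
  rw [EuclideanSpace.norm_eq]
  refine Real.sqrt_le_sqrt (Finset.sum_le_sum fun j _ => ?_)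
  rw [Real.norm_eq_abs]
  exact pow_le_one₀ (abs_nonneg _) ((abs_apply_le_frob w j).trans hw)

theorem convex_frob_le [Fact (1 ≤ p)] (c : ℝ) : Convex ℝ {w : Mat m | frob p w ≤ c} := by
  intro v hv w hw a b ha hb hab
  simp only [Set.mem_ofPred_eq] at *
  calc frob p (a • v + b • w) ≤ frob p (a • v) + frob p (b • w) := frob_add_le _ _
    _ = a * frob p v + b * frob p w := by rw [frob_smul, frob_smul, abs_of_nonneg ha, abs_of_nonneg hb]
    _ ≤ a * c + b * c := by gcongr
    _ = c := by rw [← add_mul, hab, one_mul]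

theorem frob_one (w : Mat m) : frob 1 w = ∑ j, |w j| := by
  rw [frob, PiLp.norm_eq_sum (by simp)]
  simp

theorem frob_top (w : Mat m) : frob ⊤ w = ⨆ j, |w j| := by
  simp [frob, PiLp.norm_eq_ciSup]

theorem frob_toReal (hp : 0 < p.toReal) (w : Mat m) :
    frob p w = (∑ j, |w j| ^ p.toReal) ^ (1 / p.toReal) := by
  simp [frob, PiLp.norm_eq_sum hp]

theorem inner_eq_sum (a b : Mat m) : ⟪a, b⟫ = ∑ j, a j * b j := by
  simp [PiLp.inner_apply, mul_comm]

/-- The endpoint pairs are separated because the norm is a maximum at `∞`, where the formula with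
real powers is not available. -/
theorem holder_cases (h : r⁻¹ + s⁻¹ = 1) :
    (r = 1 ∧ s = ⊤) ∨ (r = ⊤ ∧ s = 1) ∨ (r ≠ ⊤ ∧ s ≠ ⊤ ∧ r.toReal.HolderConjugate s.toReal) := by
  have H : r.HolderConjugate s := ENNReal.holderConjugate_iff.2 h
  by_cases hr : r = ⊤
  · subst hr; right; left
    simpa using h
  by_cases hs : s = ⊤
  · subst hs; left
    simpa using h
  · right; right
    refine ⟨hr, hs, ?_⟩
    exact H.toReal_of_ne_top hr hs

theorem inner_le_frob_one_mul_frob_top (a b : Mat m) : ⟪a, b⟫ ≤ frob 1 a * frob ⊤ b := by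
  rw [inner_eq_sum, frob_one, Finset.sum_mul]
  refine Finset.sum_le_sum fun j _ => (le_abs_self _).trans ?_
  rw [abs_mul]
  have : Fact ((1 : ℝ≥0∞) ≤ ⊤) := ⟨le_top⟩
  exact mul_le_mul_of_nonneg_left (abs_apply_le_frob b j) (abs_nonneg _)

/-- Hölder's inequality for the Frobenius norms. -/
theorem inner_le_frob_mul_frob (h : r⁻¹ + s⁻¹ = 1) (a b : Mat m) :
    ⟪a, b⟫ ≤ frob r a * frob s b := by
  rcases holder_cases h with ⟨rfl, rfl⟩ | ⟨rfl, rfl⟩ | ⟨hr, hs, H⟩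
  · exact inner_le_frob_one_mul_frob_top a b
  · rw [real_inner_comm, mul_comm]
    exact inner_le_frob_one_mul_frob_top b a
  · rw [inner_eq_sum, frob_toReal H.pos, frob_toReal H.symm.pos]
    exact Real.inner_le_Lp_mul_Lq _ _ _ H

theorem sign_mul_self_eq_abs (x : ℝ) : x * SignType.sign x = |x| := by
  rcases lt_trichotomy x 0 with hx | rfl | hx
  · simp [sign_neg hx, abs_of_neg hx]
  · simp
  · simp [sign_pos hx, abs_of_pos hx]

theorem abs_sign_le_one (x : ℝ) : |((SignType.sign x : SignType) : ℝ)| ≤ 1 := by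
  rcases lt_trichotomy x 0 with hx | rfl | hx
  · simp [sign_neg hx]
  · simp
  · simp [sign_pos hx]

/-- The Frobenius norms are dual to each other. -/
theorem exists_frob_le_one_inner_eq (h : r⁻¹ + s⁻¹ = 1) (a : Mat m) :
    ∃ b : Mat m, frob s b ≤ 1 ∧ ⟪a, b⟫ = frob r a := by
  -- The extremal vectors are the signs of `a` for `r = 1`, a signed unit vector at a largest entry
  -- for `r = ∞`, and otherwise the nonnegative extremizer of Hölder's inequality for `|a|` with the
  -- signs of `a` restored.
  rcases holder_cases h with ⟨rfl, rfl⟩ | ⟨rfl, rfl⟩ | ⟨hr, hs, H⟩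
  · refine ⟨WithLp.toLp 2 fun j => (SignType.sign (a j) : ℝ), ?_, ?_⟩
    · rw [frob_top]
      exact Real.iSup_le (fun j => abs_sign_le_one _) zero_le_one
    · rw [inner_eq_sum, frob_one]
      exact Finset.sum_congr rfl fun j _ => sign_mul_self_eq_abs _
  · rcases isEmpty_or_nonempty (Fin m × Fin 2) with he | hne
    · exact ⟨0, by simp [frob_one], by simp [frob_top]⟩
    · obtain ⟨j, hj⟩ := exists_eq_ciSup_of_finite (f := fun j => |a j|)
      refine ⟨EuclideanSpace.single j (SignType.sign (a j) : ℝ), ?_, ?_⟩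
      · rw [frob_one, Finset.sum_eq_single j]
        · simpa using abs_sign_le_one (a j)
        · intro i _ hi; simp [hi]
        · simp
      · rw [frob_top, ← hj, inner_eq_sum, Finset.sum_eq_single j]
        · simp
        · intro i _ hi; simp [hi]
        · simp
  · obtain ⟨c, hc, hc'⟩ := (NNReal.isGreatest_Lp Finset.univ (fun j => Real.nnabs (a j)) H).1
    refine ⟨WithLp.toLp 2 fun j => (SignType.sign (a j) : ℝ) * c j, ?_, ?_⟩
    · rw [frob_toReal H.symm.pos]
      refine Real.rpow_le_one (by positivity) ?_ H.symm.one_div_nonneg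
      refine le_trans ?_ (show ((∑ j, c j ^ s.toReal : NNReal) : ℝ) ≤ 1 by exact_mod_cast hc)
      push_cast
      refine Finset.sum_le_sum fun j _ => ?_
      refine Real.rpow_le_rpow (abs_nonneg _) ?_ H.symm.nonneg
      rw [abs_mul, NNReal.abs_eq]
      exact mul_le_of_le_one_left (c j).2 (abs_sign_le_one _)
    · rw [inner_eq_sum, frob_toReal H.pos]
      have := congrArg ((↑) : NNReal → ℝ) hc'
      push_cast at this
      rw [← this]
      refine Finset.sum_congr rfl fun j _ => ?_
      rw [← sign_mul_self_eq_abs, mul_assoc]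

theorem one_le_left_of_inv_add_inv (h : r⁻¹ + s⁻¹ = 1) : 1 ≤ r :=
  ENNReal.inv_le_one.1 (h ▸ le_self_add)

/-- A measurable selection of vectors that almost attain the dual norm. -/
theorem exists_measurable_frob_le_one [Fact (1 ≤ s)] (h : r⁻¹ + s⁻¹ = 1) {δ : ℝ} (hδ : 0 < δ) :
    ∃ d : Mat m → Mat m, Measurable d ∧ (∀ a, frob s (d a) ≤ 1) ∧
      ∀ a, frob r a ≤ ⟪a, d a⟫ + δ * ‖a‖ := by
  have hcl : IsClosed {b : Mat m | frob s b ≤ 1} := isClosed_le continuous_frob continuous_const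
  have hbd : Bornology.IsBounded {b : Mat m | frob s b ≤ 1} := by
    refine (Metric.isBounded_closedBall (x := (0 : Mat m))
      (r := Real.sqrt (∑ _j : Fin m × Fin 2, 1))).subset fun b hb => ?_
    rw [mem_closedBall_zero_iff]
    exact norm_le_of_frob_le_one hb
  have hK : IsCompact {b : Mat m | frob s b ≤ 1} := Metric.isCompact_of_isClosed_isBounded hcl hbd
  obtain ⟨t, htK, hfin, ht⟩ := hK.finite_cover_balls hδ
  -- Over a finite set a maximizer of `⟪a, ·⟫` is measurable in `a`, since each new point is
  -- compared with the best one so far. Replacing the dual unit ball by a finite `δ`-net costs at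
  -- most `δ * ‖a‖`.
  have key : ∀ t : Finset (Mat m), (∀ b ∈ t, frob s b ≤ 1) → ∃ d : Mat m → Mat m, Measurable d ∧
      (∀ a, frob s (d a) ≤ 1) ∧ ∀ a, ∀ b ∈ t, ⟪a, b⟫ ≤ ⟪a, d a⟫ := by
    intro t
    induction t using Finset.induction_on with
    | empty => exact fun _ => ⟨fun _ => 0, measurable_const, fun a => by simp [frob_zero], by simp⟩
    | insert b t hb ih =>
      intro H
      obtain ⟨d, hd, hd1, hd2⟩ := ih fun c hc => H c (Finset.mem_insert_of_mem hc)
      classical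
      refine ⟨fun a => if ⟪a, d a⟫ ≤ ⟪a, b⟫ then b else d a, ?_, ?_, ?_⟩
      · exact Measurable.ite (measurableSet_le (measurable_id.inner hd)
          (measurable_id.inner measurable_const)) measurable_const hd
      · intro a
        dsimp only
        split_ifs
        · exact H b (Finset.mem_insert_self _ _)
        · exact hd1 a
      · intro a c hc
        dsimp only
        rcases Finset.mem_insert.1 hc with rfl | hc
        · split_ifs with h1
          · exact le_rfl
          · exact (not_le.1 h1).le
        · split_ifs with h1
          · exact (hd2 a c hc).trans h1
          · exact hd2 a c hc
  obtain ⟨d, hd, hd1, hd2⟩ := key hfin.toFinset fun b hb => htK (hfin.mem_toFinset.1 hb)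
  refine ⟨d, hd, hd1, fun a => ?_⟩
  obtain ⟨b, hb, hab⟩ := exists_frob_le_one_inner_eq h a
  obtain ⟨c, hc, hbc⟩ := Set.mem_iUnion₂.1 (ht hb)
  have h1 := hd2 a c (hfin.mem_toFinset.2 hc)
  have h2 : ⟪a, b⟫ - ⟪a, c⟫ ≤ δ * ‖a‖ := by
    rw [← inner_sub_right, mul_comm]
    refine (real_inner_le_norm _ _).trans ?_
    gcongr
    rw [← dist_eq_norm]
    exact (Metric.mem_ball.1 hbc).le
  linarith

end Frob

/-! ## Mollification with a translation -/

section Mollifier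

open Filter Topology
open scoped Convolution

variable {E : Type} [NormedAddCommGroup E] [NormedSpace ℝ E]

/-- The probability measure with density the normalized bump function `ρ`. -/
def bumpMeasure (ρ : ContDiffBump (0 : Pt)) : Measure Pt :=
  volume.withDensity fun t => ENNReal.ofReal (ρ.normed volume t)

instance (ρ : ContDiffBump (0 : Pt)) : IsProbabilityMeasure (bumpMeasure ρ) := by
  constructor
  rw [bumpMeasure, withDensity_apply _ MeasurableSet.univ, Measure.restrict_univ,
    ← ofReal_integral_eq_lintegral_ofReal ρ.integrable_normed
      (Eventually.of_forall ρ.nonneg_normed), ρ.integral_normed, ENNReal.ofReal_one]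

/-- The average of the translates `F (x + a - t)`, weighted with the bump function `ρ`. -/
def moll (ρ : ContDiffBump (0 : Pt)) (a : Pt) (F : Pt → E) (x : Pt) : E :=
  ∫ t, F (x + a - t) ∂(bumpMeasure ρ)

variable (ρ : ContDiffBump (0 : Pt)) (a : Pt)

theorem measurable_ofReal_normed :
    Measurable fun t => ENNReal.ofReal (ρ.normed (volume : Measure Pt) t) :=
  ENNReal.measurable_ofReal.comp ρ.continuous_normed.measurable

theorem integral_bumpMeasure (f : Pt → E) :
    ∫ t, f t ∂(bumpMeasure ρ) = ∫ t, ρ.normed volume t • f t := by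
  rw [bumpMeasure, integral_withDensity_eq_integral_toReal_smul
    (measurable_ofReal_normed ρ)
    (Eventually.of_forall fun _ => ENNReal.ofReal_lt_top)]
  simp only [ENNReal.toReal_ofReal (ρ.nonneg_normed _)]

theorem ae_bumpMeasure_norm_lt : ∀ᵐ t ∂(bumpMeasure ρ), ‖t‖ < ρ.rOut := by
  rw [bumpMeasure, ae_withDensity_iff (measurable_ofReal_normed ρ)]
  refine Eventually.of_forall fun t ht => ?_
  have : t ∈ Function.support (ρ.normed volume) := by
    intro h0; simp [h0] at ht
  rw [ρ.support_normed_eq] at this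
  simpa using this

theorem moll_eq_convolution (F : Pt → E) (x : Pt) :
    moll ρ a F x = (ρ.normed volume ⋆[ContinuousLinearMap.lsmul ℝ ℝ, volume] F) (x + a) := by
  rw [moll, integral_bumpMeasure]; rfl

theorem contDiff_moll [CompleteSpace E] {F : Pt → E} (hF : LocallyIntegrable F volume) :
    ContDiff ℝ ∞ (moll ρ a F) := by
  have h1 : ContDiff ℝ ∞ (ρ.normed volume ⋆[ContinuousLinearMap.lsmul ℝ ℝ, volume] F) :=
    ρ.hasCompactSupport_normed.contDiff_convolution_left _ ρ.contDiff_normed hF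
  have h2 : moll ρ a F = (ρ.normed volume ⋆[ContinuousLinearMap.lsmul ℝ ℝ, volume] F) ∘
      fun x => x + a := funext fun x => moll_eq_convolution ρ a F x
  rw [h2]
  exact h1.comp (contDiff_id.add contDiff_const)

theorem pd_moll {φ : Pt → ℝ} (hφ : ContDiff ℝ ∞ φ) (hc : HasCompactSupport φ) (k : Fin 2)
    (x : Pt) : pd k (moll ρ a φ) x = moll ρ a (pd k φ) x := by
  have h1 : ContDiff ℝ 1 φ := hφ.of_le (by simp)
  have h2 := (hc.hasFDerivAt_convolution_right (ContinuousLinearMap.lsmul ℝ ℝ)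
    (ρ.integrable_normed (μ := volume)).locallyIntegrable h1 (x + a)).comp x
      ((hasFDerivAt_id x).add_const a)
  have h3 : moll ρ a φ = (ρ.normed volume ⋆[ContinuousLinearMap.lsmul ℝ ℝ, volume] φ) ∘
      fun x => x + a := funext fun x => moll_eq_convolution ρ a φ x
  rw [pd, h3]
  erw [h2.fderiv]
  rw [ContinuousLinearMap.comp_id, moll_eq_convolution]
  exact convolution_precompR_apply _ (ρ.integrable_normed (μ := volume)).locallyIntegrable
    (hc.fderiv ℝ) (h1.continuous_fderiv one_ne_zero) _ _

theorem exists_of_moll_ne_zero {F : Pt → E} {x : Pt} (h : moll ρ a F x ≠ 0) :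
    ∃ t : Pt, ‖t‖ < ρ.rOut ∧ F (x + a - t) ≠ 0 := by
  by_contra! H
  refine h (integral_eq_zero_of_ae ?_)
  filter_upwards [ae_bumpMeasure_norm_lt ρ] with t ht using H t ht

/-- An average against a probability measure stays in a closed convex set. A nonintegrable integrand
gives the default value `0`, which also satisfies the bound. -/
theorem frob_moll_le {m : ℕ} {s : ℝ≥0∞} [Fact (1 ≤ s)] {c : ℝ} (hc : 0 ≤ c) {Φ : Pt → Mat m}
    (hΦ : ∀ x, frob s (Φ x) ≤ c) (x : Pt) : frob s (moll ρ a Φ x) ≤ c := by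
  by_cases hi : Integrable (fun t => Φ (x + a - t)) (bumpMeasure ρ)
  · exact (convex_frob_le c).integral_mem (isClosed_le continuous_frob continuous_const)
      (Eventually.of_forall fun t => hΦ _) hi
  · rw [moll, integral_undef hi, frob_zero]
    exact hc

/-- Fubini, together with the evenness of the bump function: the adjoint of a mollified translation
by `a` is the one by `-a`. -/
theorem integral_moll_mul {F φ : Pt → ℝ} (hF : Integrable F) (hφ : Continuous φ)
    (hb : ∃ C, ∀ x, ‖φ x‖ ≤ C) :
    ∫ x, moll ρ a F x * φ x = ∫ y, F y * moll ρ (-a) φ y := by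
  have hint : Integrable (fun z : Pt × Pt => ρ.normed volume z.2 * F (z.1 - z.2) * φ (z.1 - a))
      (volume.prod volume) := by
    obtain ⟨C, hC⟩ := hb
    refine ((ρ.integrable_normed (μ := volume)).convolution_integrand
      (ContinuousLinearMap.mul ℝ ℝ) hF).mul_bdd (c := C) ?_ ?_
    · exact (hφ.comp (continuous_fst.sub continuous_const)).aestronglyMeasurable
    · exact Eventually.of_forall fun z => hC _
  calc ∫ x, moll ρ a F x * φ x
      = ∫ x, ∫ t, ρ.normed volume t * F (x - t) * φ (x - a) := by
        rw [← integral_sub_right_eq_self _ a]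
        refine integral_congr_ae (Eventually.of_forall fun x => ?_)
        simp only [moll, integral_bumpMeasure, smul_eq_mul, sub_add_cancel, integral_mul_const]
    _ = ∫ t, ∫ x, ρ.normed volume t * F (x - t) * φ (x - a) := integral_integral_swap hint
    _ = ∫ t, ∫ y, ρ.normed volume t * F y * φ (y + t - a) := by
        refine integral_congr_ae (Eventually.of_forall fun t => ?_)
        dsimp only
        rw [← integral_add_right_eq_self _ t]
        simp
    _ = ∫ y, ∫ t, ρ.normed volume t * F y * φ (y + t - a) := by
        refine integral_integral_swap ?_
        obtain ⟨C, hC⟩ := hb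
        refine ((ρ.integrable_normed (μ := volume)).mul_prod hF).mul_bdd (c := C) ?_
          (Eventually.of_forall fun z => hC _)
        exact (hφ.comp ((continuous_snd.add continuous_fst).sub
          continuous_const)).aestronglyMeasurable
    _ = ∫ y, F y * moll ρ (-a) φ y := by
        refine integral_congr_ae (Eventually.of_forall fun y => ?_)
        simp only [moll, integral_bumpMeasure, smul_eq_mul]
        rw [← integral_const_mul, ← integral_neg_eq_self]
        refine integral_congr_ae (Eventually.of_forall fun t => ?_)
        simp only [ρ.normed_neg]
        rw [show y + -t - a = y + -a - t by abel]
        ring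

/-- Translations act continuously on `L²`; this is continuity of the orbit map of `F` at `0`. -/
theorem tendsto_translate_eLpNorm {F : Pt → ℝ} (hF : MemLp F 2 volume) {δ : ℝ≥0∞} (hδ : 0 < δ) :
    ∃ η > 0, ∀ y : Pt, ‖y‖ < η → eLpNorm (fun x => F (x + y) - F x) 2 volume ≤ δ := by
  have : Fact ((2 : ℝ≥0∞) ≠ ⊤) := ⟨by simp⟩
  have h1 : Continuous fun y : Pt => DomAddAct.mk y +ᵥ hF.toLp F := by
    have : Continuous fun y : Pt => (DomAddAct.mk y : Ptᵈᵃᵃ) := DomAddAct.continuous_mk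
    exact this.vadd continuous_const
  obtain ⟨η, hη, H⟩ := EMetric.tendsto_nhds_nhds.1 (h1.tendsto 0) δ hδ
  obtain ⟨η', hη', hle⟩ := ENNReal.lt_iff_exists_nnreal_btwn.1 hη
  refine ⟨η', by exact_mod_cast hη', fun y hy => ?_⟩
  have h3 : edist y 0 < η := by
    rw [edist_zero_right]
    refine lt_trans ?_ hle
    rw [← ofReal_norm, ← ENNReal.ofReal_coe_nnreal]
    exact (ENNReal.ofReal_lt_ofReal_iff_of_nonneg (norm_nonneg _)).2 hy
  have h4 := (H h3).le
  rw [DomAddAct.mk_vadd_toLp, DomAddAct.mk_vadd_toLp, Lp.edist_toLp_toLp] at h4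
  refine le_trans (le_of_eq (eLpNorm_congr_ae (Eventually.of_forall fun x => ?_))) h4
  simp [add_comm]

theorem eLpNorm_two_rpow_two {α : Type} [MeasurableSpace α] {μ : Measure α} (f : α → ℝ) :
    eLpNorm f 2 μ ^ (2 : ℝ) = ∫⁻ x, ‖f x‖ₑ ^ (2 : ℝ) ∂μ :=
  eLpNorm_nnreal_pow_eq_lintegral (p := 2) two_ne_zero

theorem integrable_comp_sub_bumpMeasure {F : Pt → E} (hF : LocallyIntegrable F volume) (y : Pt) :
    Integrable (fun t => F (y - t)) (bumpMeasure ρ) := by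
  rw [bumpMeasure, integrable_withDensity_iff_integrable_smul' (measurable_ofReal_normed ρ)
    (Eventually.of_forall fun _ => ENNReal.ofReal_lt_top)]
  simp only [ENNReal.toReal_ofReal (ρ.nonneg_normed _)]
  exact (ρ.hasCompactSupport_normed (μ := volume)).convolutionExists_left
    (ContinuousLinearMap.lsmul ℝ ℝ) ρ.continuous_normed hF y

/-- Jensen's inequality for the square, obtained by comparing the `L¹` and `L²` norms for the
probability measure `bumpMeasure ρ`. -/
theorem enorm_moll_sub_rpow_two_le {F : Pt → ℝ} (hm : Measurable F)
    (hF : LocallyIntegrable F volume) (x : Pt) :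
    ‖moll ρ a F x - F x‖ₑ ^ (2 : ℝ) ≤ ∫⁻ t, ‖F (x + a - t) - F x‖ₑ ^ (2 : ℝ) ∂(bumpMeasure ρ) := by
  have h1 : moll ρ a F x - F x = ∫ t, (F (x + a - t) - F x) ∂(bumpMeasure ρ) := by
    rw [integral_sub (integrable_comp_sub_bumpMeasure ρ hF (x + a)) (integrable_const _)]
    simp [moll]
  rw [h1, ← eLpNorm_two_rpow_two]
  gcongr
  calc ‖∫ t, (F (x + a - t) - F x) ∂(bumpMeasure ρ)‖ₑ
      ≤ ∫⁻ t, ‖F (x + a - t) - F x‖ₑ ∂(bumpMeasure ρ) := enorm_integral_le_lintegral_enorm _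
    _ = eLpNorm (fun t => F (x + a - t) - F x) 1 (bumpMeasure ρ) := eLpNorm_one_eq_lintegral_enorm.symm
    _ ≤ eLpNorm (fun t => F (x + a - t) - F x) 2 (bumpMeasure ρ) := by
        refine eLpNorm_le_eLpNorm_of_exponent_le (by norm_num) ?_
        exact ((hm.comp (measurable_const.sub measurable_id)).sub
          measurable_const).aestronglyMeasurable

/-- Mollified translates converge in `L²`. -/
theorem exists_eLpNorm_moll_sub_le {F : Pt → ℝ} (hm : Measurable F) (hF : MemLp F 2 volume)
    {δ : ℝ≥0∞} (hδ : 0 < δ) : ∃ η > 0, ∀ (ρ : ContDiffBump (0 : Pt)) (a : Pt),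
      ρ.rOut + ‖a‖ < η → eLpNorm (fun x => moll ρ a F x - F x) 2 volume ≤ δ := by
  obtain ⟨η, hη, H⟩ := tendsto_translate_eLpNorm hF hδ
  refine ⟨η, hη, fun ρ a hρ => ?_⟩
  rw [← ENNReal.rpow_le_rpow_iff (z := 2) two_pos, eLpNorm_two_rpow_two]
  have hloc : LocallyIntegrable F volume := hF.locallyIntegrable (by norm_num)
  -- After Jensen and Tonelli, the inner integral is the squared `L²` distance between `F` and its
  -- translate by `a - t`, a vector shorter than `η` for almost every `t`.
  calc ∫⁻ x, ‖moll ρ a F x - F x‖ₑ ^ (2 : ℝ)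
      ≤ ∫⁻ x, ∫⁻ t, ‖F (x + a - t) - F x‖ₑ ^ (2 : ℝ) ∂(bumpMeasure ρ) :=
        lintegral_mono fun x => enorm_moll_sub_rpow_two_le ρ a hm hloc x
    _ = ∫⁻ t, (∫⁻ x, ‖F (x + a - t) - F x‖ₑ ^ (2 : ℝ)) ∂(bumpMeasure ρ) := by
        refine lintegral_lintegral_swap (Measurable.aemeasurable ?_)
        refine Measurable.pow_const (Measurable.enorm ?_) _
        exact (hm.comp ((measurable_fst.add measurable_const).sub measurable_snd)).sub
          (hm.comp measurable_fst)
    _ ≤ ∫⁻ _t, δ ^ (2 : ℝ) ∂(bumpMeasure ρ) := by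
        refine lintegral_mono_ae ?_
        filter_upwards [ae_bumpMeasure_norm_lt ρ] with t ht
        rw [← eLpNorm_two_rpow_two]
        gcongr
        have := H (a - t) ((norm_sub_le a t).trans_lt (by linarith))
        simpa only [add_sub_assoc] using this
    _ = δ ^ (2 : ℝ) := by simp

theorem moll_apply {ι : Type} [Fintype ι] {Φ : Pt → EuclideanSpace ℝ ι}
    (hΦ : LocallyIntegrable Φ volume) (x : Pt) (j : ι) :
    moll ρ a Φ x j = moll ρ a (fun y => Φ y j) x :=
  ((EuclideanSpace.proj j : EuclideanSpace ℝ ι →L[ℝ] ℝ).integral_comp_comm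
    (integrable_comp_sub_bumpMeasure ρ hΦ (x + a))).symm

open Pointwise in
theorem support_moll_subset {F : Pt → E} {K : Set Pt} (hK : Function.support F ⊆ K) :
    Function.support (moll ρ a F) ⊆ K + Metric.closedBall (-a) ρ.rOut := by
  intro x hx
  obtain ⟨t, ht, hxt⟩ := exists_of_moll_ne_zero ρ a hx
  refine Set.mem_add.2 ⟨x + a - t, hK hxt, t - a, ?_, by abel⟩
  simpa [dist_eq_norm] using ht.le

theorem exists_contDiffBump {ε : ℝ} (hε : 0 < ε) : ∃ ρ : ContDiffBump (0 : Pt), ρ.rOut = ε :=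
  ⟨⟨ε / 2, ε, by positivity, by linarith⟩, rfl⟩

end Mollifier

/-! ## The total variation of a Sobolev function -/

section Duality

open Filter Topology

theorem abs_integral_mul_le_eLpNorm {α : Type} [MeasurableSpace α] {μ : Measure α} {f h : α → ℝ}
    (hf : MemLp f 2 μ) (hh : MemLp h 2 μ) :
    |∫ x, f x * h x ∂μ| ≤ (eLpNorm f 2 μ).toReal * (eLpNorm h 2 μ).toReal := by
  have h1 : ∫ x, f x * h x ∂μ = ⟪hh.toLp h, hf.toLp f⟫ := by
    rw [L2.inner_def]
    refine integral_congr_ae ?_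
    filter_upwards [hf.coeFn_toLp, hh.coeFn_toLp] with x h1 h2
    simp [h1, h2]
  rw [h1, mul_comm, ← Lp.norm_toLp f hf, ← Lp.norm_toLp h hh]
  exact abs_real_inner_le_norm _ _

variable {Ω : Set Pt} {m : ℕ} {r s : ℝ≥0∞} [Fact (1 ≤ s)]

theorem memLp_apply {ι : Type} [Fintype ι] (f : L2 Ω (EuclideanSpace ℝ ι)) (i : ι) :
    MemLp (fun x => f x i) 2 (volume.restrict Ω) :=
  (EuclideanSpace.proj i : EuclideanSpace ℝ ι →L[ℝ] ℝ).comp_memLp' (Lp.memLp f)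

theorem measurable_coeFn_apply {ι : Type} [Fintype ι] (f : L2 Ω (EuclideanSpace ℝ ι)) (i : ι) :
    Measurable (fun x => f x i) :=
  (EuclideanSpace.proj i : EuclideanSpace ℝ ι →L[ℝ] ℝ).measurable.comp
    (Lp.stronglyMeasurable f).measurable

theorem memLp_of_frob_le_one {Φ : Pt → Mat m} (hm : Measurable Φ) (hΦ : ∀ x, frob s (Φ x) ≤ 1)
    {K : Set Pt} (hK : IsCompact K) (hs : Function.support Φ ⊆ K) (p : ℝ≥0∞) :
    MemLp Φ p volume := by
  have h1 : Φ = K.indicator Φ := (Set.indicator_eq_self.2 hs).symm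
  rw [h1, memLp_indicator_iff_restrict hK.measurableSet]
  have : IsFiniteMeasure (volume.restrict K) :=
    ⟨by rw [Measure.restrict_apply_univ]; exact hK.measure_lt_top⟩
  exact MemLp.of_bound hm.aestronglyMeasurable _
    (Eventually.of_forall fun x => norm_le_of_frob_le_one (hΦ x))

-- Mollification makes a bounded measurable field with compact support in `Ω` into a test field with
-- the same pointwise bound, and changes its pairing with `G` arbitrarily little.
open Pointwise in
theorem integral_inner_le_of_forall_isTest (hΩ : IsOpen Ω) (G : L2 Ω (Mat m)) {M : ℝ}
    (H : ∀ φ : Pt → Mat m, IsTest Ω φ → (∀ x, frob s (φ x) ≤ 1) →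
      ∫ x in Ω, ∑ j, G x j * φ x j ≤ M)
    {Φ : Pt → Mat m} (hm : Measurable Φ) (hΦ : ∀ x, frob s (Φ x) ≤ 1)
    {K : Set Pt} (hK : IsCompact K) (hKΩ : K ⊆ Ω) (hs : Function.support Φ ⊆ K) :
    ∫ x in Ω, ∑ j, G x j * Φ x j ≤ M := by
  have hL := memLp_of_frob_le_one hm hΦ hK hs
  have hloc : LocallyIntegrable Φ volume := (hL 2).locallyIntegrable (by norm_num)
  have hΦj : ∀ j, MemLp (fun x => Φ x j) 2 volume := fun j =>
    (EuclideanSpace.proj j : Mat m →L[ℝ] ℝ).comp_memLp' (hL 2)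
  have hmj : ∀ j, Measurable fun x => Φ x j := fun j =>
    (EuclideanSpace.proj j : Mat m →L[ℝ] ℝ).measurable.comp hm
  refine le_of_forall_pos_le_add fun κ hκ => ?_
  set C : ℝ := ∑ j, (eLpNorm (fun x => G x j) 2 (volume.restrict Ω)).toReal with hC
  have hC0 : 0 ≤ C := Finset.sum_nonneg fun j _ => ENNReal.toReal_nonneg
  -- By Cauchy–Schwarz the total error is at most `C` times the `L²` tolerance of the components;
  -- the added `1` covers `C = 0`.
  have hδ : 0 < κ / (C + 1) := by positivity
  choose η hη hconv using fun j => exists_eLpNorm_moll_sub_le (hmj j) (hΦj j)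
    (ENNReal.ofReal_pos.2 hδ)
  obtain ⟨ε₁, hε₁, hsub⟩ := hK.exists_cthickening_subset_open hΩ hKΩ
  obtain ⟨ε, hε, hε1, hεη⟩ : ∃ ε > 0, ε ≤ ε₁ ∧ ∀ j, ε < η j := by
    have h1 : ∀ᶠ ε in 𝓝[>] (0 : ℝ), ε ≤ ε₁ ∧ ∀ j, ε < η j :=
      (eventually_nhdsWithin_of_eventually_nhds (eventually_le_nhds hε₁)).and
        (eventually_all.2 fun j =>
          eventually_nhdsWithin_of_eventually_nhds (eventually_lt_nhds (hη j)))
    obtain ⟨ε, h2, h3⟩ := (h1.and self_mem_nhdsWithin).exists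
    exact ⟨ε, h3, h2⟩
  obtain ⟨ρ, hρ⟩ := exists_contDiffBump hε
  have hsupp : tsupport (moll ρ 0 Φ) ⊆ K + Metric.closedBall 0 ε := by
    refine closure_minimal ?_ (hK.add (isCompact_closedBall _ _)).isClosed
    have := support_moll_subset ρ 0 hs
    rwa [neg_zero, hρ] at this
  have htest : IsTest Ω (moll ρ 0 Φ) := by
    refine ⟨contDiff_moll ρ 0 hloc, (hK.add (isCompact_closedBall 0 ε)).of_isClosed_subset
      (isClosed_tsupport _) hsupp, hsupp.trans (Set.Subset.trans ?_ hsub)⟩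
    rw [hK.add_closedBall_zero hε.le]
    exact Metric.cthickening_mono hε1 K
  have hmollj : ∀ j, MemLp (fun x => moll ρ 0 Φ x j) 2 (volume.restrict Ω) := fun j =>
    (EuclideanSpace.proj j : Mat m →L[ℝ] ℝ).comp_memLp'
      ((htest.1.continuous.memLp_of_hasCompactSupport htest.2.1))
  have hdiff : ∀ j, |∫ x in Ω, G x j * (moll ρ 0 Φ x j - Φ x j)|
      ≤ (eLpNorm (fun x => G x j) 2 (volume.restrict Ω)).toReal * (κ / (C + 1)) := by
    intro j
    refine (abs_integral_mul_le_eLpNorm (memLp_apply G j) ((hmollj j).sub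
      ((hΦj j).restrict Ω))).trans ?_
    gcongr
    refine ENNReal.toReal_le_of_le_ofReal hδ.le ?_
    refine (eLpNorm_mono_measure _ Measure.restrict_le_self).trans ?_
    simp only [moll_apply ρ 0 hloc]
    exact hconv j ρ 0 (by rw [hρ, norm_zero, add_zero]; exact hεη j)
  have h1 := H _ htest (frob_moll_le ρ 0 zero_le_one hΦ)
  have hi1 : ∀ j, Integrable (fun x => G x j * Φ x j) (volume.restrict Ω) := fun j =>
    (memLp_apply G j).integrable_mul ((hΦj j).restrict Ω)
  have hi2 : ∀ j, Integrable (fun x => G x j * moll ρ 0 Φ x j) (volume.restrict Ω) := fun j =>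
    (memLp_apply G j).integrable_mul (hmollj j)
  rw [integral_finsetSum _ fun j _ => hi2 j] at h1
  rw [integral_finsetSum _ fun j _ => hi1 j]
  have h2 : ∑ j, ∫ x in Ω, G x j * Φ x j
      ≤ ∑ j, ((∫ x in Ω, G x j * moll ρ 0 Φ x j)
        + (eLpNorm (fun x => G x j) 2 (volume.restrict Ω)).toReal * (κ / (C + 1))) := by
    refine Finset.sum_le_sum fun j _ => ?_
    have := hdiff j
    simp only [mul_sub] at this
    rw [integral_sub (hi2 j) (hi1 j)] at this
    linarith [neg_le_of_abs_le this]
  refine h2.trans ?_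
  rw [Finset.sum_add_distrib, ← Finset.sum_mul, ← hC]
  have h3 : C * (κ / (C + 1)) ≤ κ := by
    rw [mul_div_assoc', div_le_iff₀ (by positivity)]
    nlinarith
  linarith

theorem integrable_frob [IsFiniteMeasure (volume.restrict Ω)] [Fact (1 ≤ r)] (G : L2 Ω (Mat m)) :
    Integrable (fun x => frob r (G x)) (volume.restrict Ω) := by
  have h1 : MemLp (fun x => frobMap m r (G x)) 2 (volume.restrict Ω) :=
    (frobMap m r).comp_memLp' (Lp.memLp G)
  exact (h1.integrable (by norm_num)).norm

/-- The integral of `|G|_{F,r}` is at most the supremum of the integrals of `G · φ` over the test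
fields `φ` with `|φ|_{F,s} ≤ 1`. -/
theorem integral_frob_le_of_forall_isTest [IsFiniteMeasure (volume.restrict Ω)] [Fact (1 ≤ r)]
    (hΩ : IsOpen Ω) (hbdd : Bornology.IsBounded Ω) (h : r⁻¹ + s⁻¹ = 1) (G : L2 Ω (Mat m)) {M : ℝ}
    (H : ∀ φ : Pt → Mat m, IsTest Ω φ → (∀ x, frob s (φ x) ≤ 1) →
      ∫ x in Ω, ∑ j, G x j * φ x j ≤ M) :
    ∫ x in Ω, frob r (G x) ≤ M := by
  have hG : Measurable G := (Lp.stronglyMeasurable G).measurable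
  have hGi : Integrable (fun x => ‖G x‖) (volume.restrict Ω) :=
    ((Lp.memLp G).integrable (by norm_num)).norm
  have hfi := integrable_frob (r := r) G
  have hcompact : ∀ K ⊆ Ω, IsCompact K → ∫ x in K, frob r (G x) ≤ M := by
    intro K hKΩ hK
    refine le_of_forall_pos_le_add fun κ hκ => ?_
    set C : ℝ := ∫ x in Ω, ‖G x‖
    have hC0 : 0 ≤ C := integral_nonneg fun _ => norm_nonneg _
    have hδ : 0 < κ / (C + 1) := by positivity
    -- The field `d ∘ G`, cut off outside `K`, is an almost optimal competitor; its defect is at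
    -- most `κ / (C + 1)` times the integral of `‖G‖`.
    obtain ⟨d, hd, hd1, hd2⟩ := exists_measurable_frob_le_one (m := m) h hδ
    have h1 := integral_inner_le_of_forall_isTest hΩ G H (Φ := K.indicator (d ∘ G))
      ((hd.comp hG).indicator hK.measurableSet)
      (fun x => by
        by_cases hx : x ∈ K
        · simpa [hx] using hd1 _
        · simp [hx, frob_zero]) hK hKΩ Set.support_indicator_subset
    have h2 : ∫ x in Ω, ∑ j, G x j * K.indicator (d ∘ G) x j
        = ∫ x in K, ⟪G x, d (G x)⟫ := by
      have : ∀ x, ∑ j, G x j * K.indicator (d ∘ G) x j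
          = K.indicator (fun x => ⟪G x, d (G x)⟫) x := by
        intro x
        by_cases hx : x ∈ K
        · simp [hx, inner_eq_sum]
        · simp [hx]
      simp only [this]
      rw [setIntegral_indicator hK.measurableSet, Set.inter_eq_right.2 hKΩ]
    rw [h2] at h1
    have hmono : volume.restrict K ≤ volume.restrict Ω := Measure.restrict_mono hKΩ le_rfl
    have hdi : Integrable (fun x => ⟪G x, d (G x)⟫) (volume.restrict K) := by
      refine (hGi.mono_measure hmono).mul_const
        (Real.sqrt (∑ _j : Fin m × Fin 2, 1)) |>.mono'
        (hG.inner (hd.comp hG)).aestronglyMeasurable (Eventually.of_forall fun x => ?_)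
      refine (abs_real_inner_le_norm _ _).trans ?_
      gcongr
      exact norm_le_of_frob_le_one (hd1 _)
    calc ∫ x in K, frob r (G x) ≤ ∫ x in K, (⟪G x, d (G x)⟫ + κ / (C + 1) * ‖G x‖) :=
          integral_mono (hfi.mono_measure hmono)
            (hdi.add ((hGi.mono_measure hmono).const_mul _)) fun x => hd2 _
      _ = (∫ x in K, ⟪G x, d (G x)⟫) + κ / (C + 1) * ∫ x in K, ‖G x‖ := by
          rw [integral_add hdi ((hGi.mono_measure hmono).const_mul _), integral_const_mul]
      _ ≤ M + κ / (C + 1) * C := by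
          gcongr
          exact integral_mono_measure hmono (Eventually.of_forall fun _ => norm_nonneg _) hGi
      _ ≤ M + κ := by
          gcongr
          rw [div_mul_eq_mul_div, div_le_iff₀ (by positivity)]
          nlinarith
  -- Boundedness makes the closed sets of this increasing exhaustion compact, so the bound on
  -- compact sets passes to `Ω` in the limit.
  obtain ⟨F, hFc, hFΩ, hFU, hFm⟩ := hΩ.exists_iUnion_isClosed
  have hlim := tendsto_setIntegral_of_monotone (μ := volume) (f := fun x => frob r (G x))
    (fun n => (hFc n).measurableSet) hFm (by rw [hFU]; exact hfi)
  rw [hFU] at hlim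
  exact le_of_tendsto' hlim fun n => hcompact _ (hFΩ n)
    (Metric.isCompact_of_isClosed_isBounded (hFc n) (hbdd.subset (hFΩ n)))

end Duality

/-! ## A partition of unity with inward translations -/

section Geometry

open Filter Topology
open scoped Manifold

/-- Near each point of its closure, a Lipschitz domain is mapped into itself by the translations in
some direction, even after a perturbation of comparable size. -/
theorem exists_inward_direction {Ω : Set Pt} (hΩ : IsOpen Ω) (hLip : HasLipschitzBoundary Ω)
    {x : Pt} (hx : x ∈ closure Ω) : ∃ δ > 0, ∃ a : Pt, ∃ ε₀ > 0, ∀ ε > 0, ε < ε₀ → ∀ y ∈ Ω, ∀ t : Pt,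
      ‖t‖ ≤ ε → y + ε • a + t ∈ Metric.ball x δ → y + ε • a + t ∈ Ω := by
  by_cases hxΩ : x ∈ Ω
  · obtain ⟨δ, hδ, hsub⟩ := Metric.isOpen_iff.1 hΩ x hxΩ
    exact ⟨δ, hδ, 0, 1, one_pos, fun ε _ _ y _ t _ h => hsub h⟩
  obtain ⟨Φ, γ, K, δ, hδ, hγ, hchart⟩ := hLip x ⟨hx, by rwa [hΩ.interior_eq]⟩
  -- In the chart, the shift by `ε • a` raises a point by `ε * (K + 1)`. The perturbation lowers it
  -- by at most `ε`, and moves it sideways by at most `ε`, over which the graph rises by at most `K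
  -- * ε`. So the point stays above the graph.
  set a : Pt := Φ.symm (EuclideanSpace.single 1 ((K : ℝ) + 1)) with ha
  -- The displacement is shorter than `δ / 2`, so the starting point `y` also lies in the ball of
  -- radius `δ` on which the chart describes `Ω`.
  refine ⟨δ / 2, by positivity, a, δ / 2 / (‖a‖ + 1), by positivity, ?_⟩
  intro ε hε hε₀ y hy t ht hball
  have hsmall : ε * (‖a‖ + 1) < δ / 2 := (lt_div_iff₀ (by positivity)).1 hε₀
  have hnorm : ‖ε • a + t‖ ≤ ε * (‖a‖ + 1) := by
    refine (norm_add_le _ _).trans ?_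
    rw [norm_smul, Real.norm_of_nonneg hε.le]
    linarith
  have hy' : y ∈ Metric.ball x δ := by
    rw [Metric.mem_ball, dist_eq_norm] at hball ⊢
    have : y - x = (y + ε • a + t - x) - (ε • a + t) := by abel
    rw [this]
    exact (norm_sub_le _ _).trans_lt (by linarith)
  rw [hchart _ (Metric.ball_subset_ball (by linarith) hball)]
  have h1 := (hchart y hy').1 hy
  have hΦ0 : Φ (y + ε • a + t) 0 = Φ y 0 + Φ t 0 := by
    simp [ha]
  have hΦ1 : Φ (y + ε • a + t) 1 = Φ y 1 + ε * (K + 1) + Φ t 1 := by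
    simp [ha]
  have hb : ∀ k, |Φ t k| ≤ ε := fun k => by
    rw [← Real.norm_eq_abs]
    exact (PiLp.norm_apply_le (Φ t) k).trans (by rwa [Φ.norm_map])
  rw [hΦ0, hΦ1]
  have h2 : |γ (Φ y 0 + Φ t 0) - γ (Φ y 0)| ≤ K * ε := by
    have := hγ.dist_le_mul (Φ y 0 + Φ t 0) (Φ y 0)
    rw [Real.dist_eq, Real.dist_eq, add_sub_cancel_left] at this
    exact this.trans (mul_le_mul_of_nonneg_left (hb 0) K.2)
  have h3 := (abs_le.1 h2).2
  have h4 := (abs_le.1 (hb 1)).1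
  linarith

/-- A smooth partition of unity on a bounded Lipschitz domain, with a direction of translations
for each of its members. -/
theorem exists_partition_inward {Ω : Set Pt} (hΩ : IsOpen Ω) (hbdd : Bornology.IsBounded Ω)
    (hLip : HasLipschitzBoundary Ω) : ∃ (ι : Type) (_ : Fintype ι) (ζ : ι → Pt → ℝ) (a : ι → Pt),
      (∀ i, ContDiff ℝ ∞ (ζ i)) ∧ (∀ i x, 0 ≤ ζ i x) ∧ (∀ x, ∑ i, ζ i x ≤ 1) ∧
      (∀ x ∈ Ω, ∑ i, ζ i x = 1) ∧
      ∃ ε₀ > 0, ∀ i, ∀ ε > 0, ε < ε₀ → ∀ y ∈ Ω, ∀ t : Pt,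
        ‖t‖ ≤ ε → y + ε • a i + t ∈ tsupport (ζ i) → y + ε • a i + t ∈ Ω := by
  choose δ hδ a ε₀ hε₀ H using fun x : closure Ω => exists_inward_direction hΩ hLip x.2
  have hcomp : IsCompact (closure Ω) := hbdd.isCompact_closure
  obtain ⟨t, ht⟩ := hcomp.elim_finite_subcover (fun x : closure Ω => Metric.ball (x : Pt) (δ x))
    (fun x => Metric.isOpen_ball) fun x hx =>
      Set.mem_iUnion.2 ⟨⟨x, hx⟩, Metric.mem_ball_self (hδ _)⟩
  obtain ⟨f, hf⟩ := SmoothPartitionOfUnity.exists_isSubordinate 𝓘(ℝ, Pt) (s := closure Ω)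
    isClosed_closure (fun i : t => Metric.ball ((i : closure Ω) : Pt) (δ i))
    (fun i => Metric.isOpen_ball) (by
      intro x hx
      obtain ⟨i, hi, hxi⟩ := Set.mem_iUnion₂.1 (ht hx)
      exact Set.mem_iUnion.2 ⟨⟨i, hi⟩, hxi⟩)
  refine ⟨t, inferInstance, fun i => f i, fun i => a i, fun i => (f i).contMDiff.contDiff,
    fun i x => f.nonneg i x, fun x => ?_, fun x hx => ?_, ?_⟩
  · rw [← finsum_eq_sum_of_fintype]; exact f.sum_le_one x
  · rw [← finsum_eq_sum_of_fintype]; exact f.sum_eq_one (subset_closure hx)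
  -- Compactness has left finitely many balls, hence a common bound for the step sizes.
  · obtain ⟨ε, hε, hle⟩ : ∃ ε > 0, ∀ i : t, ε < ε₀ i := by
      have h1 : ∀ᶠ ε in 𝓝[>] (0 : ℝ), ∀ i : t, ε < ε₀ i := eventually_all.2 fun i =>
        eventually_nhdsWithin_of_eventually_nhds (eventually_lt_nhds (hε₀ i))
      obtain ⟨ε, h2, h3⟩ := (h1.and self_mem_nhdsWithin).exists
      exact ⟨ε, h3, h2⟩
    exact ⟨ε, hε, fun i ε' hε' hlt y hy t ht hmem =>
      H i ε' hε' (hlt.trans (hle i)) y hy t ht (hf i hmem)⟩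

end Geometry

/-! ## Smooth functions in `H¹` and approximation in variation -/

section Approximation

open Filter Topology

variable {Ω : Set Pt} {m : ℕ}

theorem isFiniteMeasure_restrict_of_isBounded (hbdd : Bornology.IsBounded Ω) :
    IsFiniteMeasure (volume.restrict Ω) :=
  ⟨by rw [Measure.restrict_apply_univ]; exact hbdd.measure_lt_top⟩

theorem exists_bound_of_continuous {F : Type} [NormedAddCommGroup F] (hbdd : Bornology.IsBounded Ω)
    {θ : Pt → F} (hθ : Continuous θ) : ∃ C, ∀ x ∈ Ω, ‖θ x‖ ≤ C := by
  obtain ⟨C, hC⟩ := hbdd.isCompact_closure.exists_bound_of_continuousOn hθ.continuousOn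
  exact ⟨C, fun x hx => hC x (subset_closure hx)⟩

theorem memLp_restrict_of_continuous {F : Type} [NormedAddCommGroup F]
    [SecondCountableTopologyEither Pt F] (hΩ : IsOpen Ω)
    (hbdd : Bornology.IsBounded Ω) {θ : Pt → F} (hθ : Continuous θ) (p : ℝ≥0∞) :
    MemLp θ p (volume.restrict Ω) := by
  have := isFiniteMeasure_restrict_of_isBounded hbdd
  obtain ⟨C, hC⟩ := exists_bound_of_continuous hbdd hθ
  exact MemLp.of_bound hθ.aestronglyMeasurable C
    ((ae_restrict_iff' hΩ.measurableSet).2 (Eventually.of_forall hC))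

theorem continuous_pd {φ : Pt → ℝ} (h : ContDiff ℝ ∞ φ) (k : Fin 2) : Continuous (pd k φ) :=
  (h.continuous_fderiv (by simp)).clm_apply continuous_const

theorem pd_eq_zero_of_notMem_tsupport {φ : Pt → ℝ} {k : Fin 2} {x : Pt} (hx : x ∉ tsupport φ) :
    pd k φ x = 0 := by
  have : fderiv ℝ φ x = 0 := by
    by_contra h
    exact hx (support_fderiv_subset ℝ h)
  rw [pd, this, _root_.zero_apply]

theorem pd_mul {θ φ : Pt → ℝ} (hθ : ContDiff ℝ ∞ θ) (hφ : ContDiff ℝ ∞ φ) (k : Fin 2) (x : Pt) :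
    pd k (fun y => θ y * φ y) x = θ x * pd k φ x + pd k θ x * φ x := by
  rw [pd, fderiv_fun_mul (hθ.differentiable (by simp) x) (hφ.differentiable (by simp) x)]
  simp [pd, mul_comm]

theorem pd_sum {ι : Type} [Fintype ι] {φ : ι → Pt → ℝ} (hφ : ∀ i, ContDiff ℝ ∞ (φ i)) (k : Fin 2)
    (x : Pt) : pd k (fun y => ∑ i, φ i y) x = ∑ i, pd k (φ i) x := by
  rw [pd, fderiv_fun_sum fun i _ => (hφ i).differentiable (by simp) x]
  simp [pd]

theorem pd_apply {ι : Type} [Fintype ι] {φ : Pt → EuclideanSpace ℝ ι} (hφ : ContDiff ℝ ∞ φ)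
    (k : Fin 2) (x : Pt) (j : ι) : pd k φ x j = pd k (fun y => φ y j) x := by
  have h := (EuclideanSpace.proj j : EuclideanSpace ℝ ι →L[ℝ] ℝ).hasFDerivAt.comp x
    (hφ.differentiable (by simp) x).hasFDerivAt
  have h' : HasFDerivAt (fun y => φ y j) _ x := h
  rw [pd, pd, h'.fderiv]
  rfl

theorem IsTest.apply {ι : Type} [Fintype ι] {φ : Pt → EuclideanSpace ℝ ι} (h : IsTest Ω φ) (j : ι) :
    IsTest Ω fun x => φ x j := by
  have hsub : tsupport (fun x => φ x j) ⊆ tsupport φ := by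
    refine closure_mono fun x hx h0 => hx ?_
    simp [h0]
  exact ⟨(EuclideanSpace.proj j : EuclideanSpace ℝ ι →L[ℝ] ℝ).contDiff.comp h.1,
    h.2.1.of_isClosed_subset (isClosed_tsupport _) hsub, hsub.trans h.2.2⟩

theorem integral_mul_pd_eq_neg {W φ : Pt → ℝ} (hW : ContDiff ℝ ∞ W) (hφ : ContDiff ℝ ∞ φ)
    (hc : HasCompactSupport φ) (k : Fin 2) :
    ∫ x, W x * pd k φ x = - ∫ x, pd k W x * φ x := by
  have hpc : HasCompactSupport (pd k φ) := hc.fderiv_apply ℝ _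
  refine integral_mul_fderiv_eq_neg_fderiv_mul_of_integrable ?_ ?_ ?_ ?_ ?_
  · exact ((continuous_pd hW k).mul hφ.continuous).integrable_of_hasCompactSupport hc.mul_left
  · exact (hW.continuous.mul (continuous_pd hφ k)).integrable_of_hasCompactSupport hpc.mul_left
  · exact (hW.continuous.mul hφ.continuous).integrable_of_hasCompactSupport hc.mul_left
  · exact fun x _ => hW.differentiable (by simp) x
  · exact fun x _ => hφ.differentiable (by simp) x

theorem IsTest.eq_zero_of_notMem {F : Type} [NormedAddCommGroup F] [NormedSpace ℝ F] {φ : Pt → F}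
    (h : IsTest Ω φ) {x : Pt} (hx : x ∉ Ω) : φ x = 0 :=
  image_eq_zero_of_notMem_tsupport fun h' => hx (h.2.2 h')

theorem IsTest.pd_eq_zero_of_notMem {φ : Pt → ℝ} (h : IsTest Ω φ) (k : Fin 2) {x : Pt}
    (hx : x ∉ Ω) : pd k φ x = 0 :=
  pd_eq_zero_of_notMem_tsupport fun h' => hx (h.2.2 h')

/-- On a bounded domain, smooth functions on the plane restrict to elements of `H¹`. -/
theorem exists_H1_of_contDiff (hΩ : IsOpen Ω) (hbdd : Bornology.IsBounded Ω) (W : Fin m → Pt → ℝ)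
    (hW : ∀ n, ContDiff ℝ ∞ (W n)) : ∃ w : H1 Ω m,
      ∀ᵐ x ∂(volume.restrict Ω), ∀ n, incl Ω m w x n = W n x := by
  have h1 : MemLp (fun x => (WithLp.toLp 2 fun n => W n x : Vec m)) 2 (volume.restrict Ω) :=
    memLp_restrict_of_continuous hΩ hbdd
      ((PiLp.continuous_toLp 2 _).comp (continuous_pi fun n => (hW n).continuous)) 2
  have h2 : MemLp (fun x => (WithLp.toLp 2 fun j : Fin m × Fin 2 => pd j.2 (W j.1) x : Mat m)) 2
      (volume.restrict Ω) :=
    memLp_restrict_of_continuous hΩ hbdd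
      ((PiLp.continuous_toLp 2 _).comp (continuous_pi fun j : Fin m × Fin 2 => continuous_pd (hW j.1) j.2)) 2
  have e1 := h1.coeFn_toLp
  have e2 := h2.coeFn_toLp
  refine ⟨⟨WithLp.toLp 2 (h1.toLp _, h2.toLp _), fun φ hφ n k => ?_⟩, ?_⟩
  · change ∫ x in Ω, h1.toLp _ x n * pd k φ x = - ∫ x in Ω, h2.toLp _ x (n, k) * φ x
    have e3 : ∫ x in Ω, h1.toLp _ x n * pd k φ x = ∫ x in Ω, W n x * pd k φ x :=
      integral_congr_ae (by filter_upwards [e1] with x hx; rw [hx])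
    have e4 : ∫ x in Ω, h2.toLp _ x (n, k) * φ x = ∫ x in Ω, pd k (W n) x * φ x :=
      integral_congr_ae (by filter_upwards [e2] with x hx; rw [hx])
    rw [e3, e4, setIntegral_eq_integral_of_forall_compl_eq_zero fun x hx => by
        rw [hφ.pd_eq_zero_of_notMem k hx, mul_zero],
      setIntegral_eq_integral_of_forall_compl_eq_zero fun x hx => by
        rw [hφ.eq_zero_of_notMem hx, mul_zero]]
    exact integral_mul_pd_eq_neg (hW n) hφ.1 hφ.2.1 k
  · filter_upwards [e1] with x hx n
    exact congrArg (fun y : Vec m => y n) hx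

/-- The product `θ v_n`, extended by zero. -/
def zeroExt (v : L2 Ω (Vec m)) (n : Fin m) (θ : Pt → ℝ) : Pt → ℝ :=
  Ω.indicator fun x => θ x * v x n

variable (v : L2 Ω (Vec m)) (n : Fin m)

theorem measurable_zeroExt (hΩ : IsOpen Ω) {θ : Pt → ℝ} (hθ : Continuous θ) :
    Measurable (zeroExt v n θ) :=
  (hθ.measurable.mul (measurable_coeFn_apply v n)).indicator hΩ.measurableSet

theorem memLp_mul_apply (hΩ : IsOpen Ω) (hbdd : Bornology.IsBounded Ω) {θ : Pt → ℝ}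
    (hθ : Continuous θ) : MemLp (fun x => θ x * v x n) 2 (volume.restrict Ω) := by
  obtain ⟨C, hC⟩ := exists_bound_of_continuous hbdd hθ
  refine (memLp_apply v n).of_le_mul (c := C)
    (hθ.measurable.mul (measurable_coeFn_apply v n)).aestronglyMeasurable ?_
  refine (ae_restrict_iff' hΩ.measurableSet).2 (Eventually.of_forall fun x hx => ?_)
  rw [norm_mul]
  exact mul_le_mul_of_nonneg_right (hC x hx) (norm_nonneg _)

theorem memLp_zeroExt (hΩ : IsOpen Ω) (hbdd : Bornology.IsBounded Ω) {θ : Pt → ℝ}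
    (hθ : Continuous θ) : MemLp (zeroExt v n θ) 2 volume :=
  (memLp_indicator_iff_restrict hΩ.measurableSet).2 (memLp_mul_apply v n hΩ hbdd hθ)

theorem integrable_mul_apply (hΩ : IsOpen Ω) (hbdd : Bornology.IsBounded Ω) {θ : Pt → ℝ}
    (hθ : Continuous θ) : Integrable (fun x => θ x * v x n) (volume.restrict Ω) := by
  have := isFiniteMeasure_restrict_of_isBounded hbdd
  exact (memLp_mul_apply v n hΩ hbdd hθ).integrable (by norm_num)

theorem integrable_zeroExt (hΩ : IsOpen Ω) (hbdd : Bornology.IsBounded Ω) {θ : Pt → ℝ}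
    (hθ : Continuous θ) : Integrable (zeroExt v n θ) :=
  (integrable_indicator_iff hΩ.measurableSet).2 (integrable_mul_apply v n hΩ hbdd hθ)

theorem integral_zeroExt_mul (hΩ : IsOpen Ω) (θ φ : Pt → ℝ) :
    ∫ x, zeroExt v n θ x * φ x = ∫ x in Ω, θ x * φ x * v x n := by
  rw [← integral_indicator hΩ.measurableSet]
  refine integral_congr_ae (Eventually.of_forall fun x => ?_)
  by_cases hx : x ∈ Ω
  · simp only [zeroExt, Set.indicator_of_mem hx]; ring
  · simp [zeroExt, hx]

/-- The mollifier is moved to the smooth function `φ`, where it commutes with `∂_k`, and the product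
rule then moves `θ` under the derivative. Nothing is differentiated that contains `v`, which need
not have a weak gradient. -/
theorem integral_moll_zeroExt_mul_pd (hΩ : IsOpen Ω) (hbdd : Bornology.IsBounded Ω)
    (ρ : ContDiffBump (0 : Pt)) (a : Pt) {θ φ : Pt → ℝ} (hθ : ContDiff ℝ ∞ θ)
    (hφ : ContDiff ℝ ∞ φ) (hc : HasCompactSupport φ) (k : Fin 2) :
    ∫ x, moll ρ a (zeroExt v n θ) x * pd k φ x
      = (∫ x in Ω, v x n * pd k (fun y => θ y * moll ρ (-a) φ y) x)
        - ∫ x, moll ρ a (zeroExt v n (pd k θ)) x * φ x := by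
  have hpc : HasCompactSupport (pd k φ) := hc.fderiv_apply ℝ _
  have hm : ContDiff ℝ ∞ (moll ρ (-a) φ) :=
    contDiff_moll ρ (-a) hφ.continuous.locallyIntegrable
  rw [integral_moll_mul ρ a (integrable_zeroExt v n hΩ hbdd hθ.continuous) (continuous_pd hφ k)
      (hpc.exists_bound_of_continuous (continuous_pd hφ k)),
    integral_moll_mul ρ a (integrable_zeroExt v n hΩ hbdd (continuous_pd hθ k)) hφ.continuous
      (hc.exists_bound_of_continuous hφ.continuous),
    integral_zeroExt_mul v n hΩ, integral_zeroExt_mul v n hΩ, eq_sub_iff_add_eq,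
    ← integral_add]
  · refine integral_congr_ae (Eventually.of_forall fun x => ?_)
    dsimp only
    rw [pd_mul hθ hm, pd_moll ρ (-a) hφ hc]
    ring
  · simp only [← pd_moll ρ (-a) hφ hc k]
    exact integrable_mul_apply v n hΩ hbdd (hθ.continuous.mul (continuous_pd hm k))
  · exact integrable_mul_apply v n hΩ hbdd ((continuous_pd hθ k).mul hm.continuous)

end Approximation

/-! ### Approximation of functions of bounded variation by `H¹` functions -/

section Relaxation

open Filter Topology

variable {Ω : Set Pt} {m : ℕ}

theorem IsTest.neg {F : Type} [NormedAddCommGroup F] [NormedSpace ℝ F] {φ : Pt → F}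
    (h : IsTest Ω φ) : IsTest Ω fun x => -φ x := by
  have hsub : tsupport (fun x => -φ x) ⊆ tsupport φ :=
    closure_mono fun x hx h0 => hx (by simp [h0])
  exact ⟨h.1.neg, h.2.1.of_isClosed_subset (isClosed_tsupport _) hsub, hsub.trans h.2.2⟩

theorem le_toReal_totalVariation {s : ℝ≥0∞} {v : L2 Ω (Vec m)} (hv : totalVariation s v ≠ ⊤)
    {φ : Pt → Mat m} (hφ : IsTest Ω φ) (hs : ∀ x, frob s (φ x) ≤ 1) :
    ∫ x in Ω, ∑ n, v x n * ∑ k, pd k φ x (n, k) ≤ (totalVariation s v).toReal := by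
  refine (ENNReal.ofReal_le_iff_le_toReal hv).1 ?_
  exact le_iSup₂_of_le φ ⟨hφ, hs⟩ le_rfl

theorem neg_toReal_totalVariation_le {s : ℝ≥0∞} [Fact (1 ≤ s)] {v : L2 Ω (Vec m)}
    (hv : totalVariation s v ≠ ⊤) {φ : Pt → Mat m} (hφ : IsTest Ω φ) (hs : ∀ x, frob s (φ x) ≤ 1) :
    -(totalVariation s v).toReal ≤ ∫ x in Ω, ∑ n, v x n * ∑ k, pd k φ x (n, k) := by
  have h := le_toReal_totalVariation hv hφ.neg fun x => by rw [frob_neg]; exact hs x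
  have e : ∀ k x, pd k (fun x => -φ x) x = -pd k φ x := fun k x => by
    simp [pd, fderiv_fun_neg]
  simp only [e, PiLp.neg_apply, Finset.sum_neg_distrib, mul_neg, integral_neg] at h
  linarith

variable {ι : Type} [Fintype ι]

open Pointwise in
/-- The adjoint of averaging over inward translates maps test fields to test fields. -/
theorem isTest_sum_mul_moll {E : Type} [NormedAddCommGroup E] [NormedSpace ℝ E] [CompleteSpace E]
    {ζ : ι → Pt → ℝ} {b : ι → Pt} {ρ : ContDiffBump (0 : Pt)} (hζ : ∀ i, ContDiff ℝ ∞ (ζ i))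
    (hb : ∀ i, ∀ y ∈ Ω, ∀ t : Pt, ‖t‖ ≤ ρ.rOut → y + b i + t ∈ tsupport (ζ i) → y + b i + t ∈ Ω)
    {φ : Pt → E} (hφ : IsTest Ω φ) :
    IsTest Ω fun x => ∑ i, ζ i x • moll ρ (-b i) φ x := by
  -- These are the points reached from the support of `φ` by the shift `b i` and a perturbation of
  -- size at most `ρ.rOut`, cut off by the support of `ζ i`; `hb` says precisely that they stay in
  -- `Ω`.
  set K : Set Pt := ⋃ i, tsupport (ζ i) ∩ (tsupport φ + Metric.closedBall (b i) ρ.rOut)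
  have hK : IsCompact K := isCompact_iUnion fun i =>
    (hφ.2.1.isCompact.add (isCompact_closedBall _ _)).inter_left (isClosed_tsupport _)
  have hKΩ : K ⊆ Ω := by
    refine Set.iUnion_subset fun i x hx => ?_
    obtain ⟨h1, y, hy, t, ht, rfl⟩ := hx
    have h2 := hb i y (hφ.2.2 hy) (t - b i) (by simpa [dist_eq_norm] using ht)
    have h3 : y + b i + (t - b i) = y + t := by abel
    rw [h3] at h2
    exact h2 h1
  have hsupp : tsupport (fun x => ∑ i, ζ i x • moll ρ (-b i) φ x) ⊆ K := by
    refine closure_minimal (fun x hx => ?_) hK.isClosed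
    obtain ⟨i, -, hi⟩ := Finset.exists_ne_zero_of_sum_ne_zero hx
    have h1 : ζ i x ≠ 0 := fun h => hi (by rw [h, zero_smul])
    have h2 : moll ρ (-b i) φ x ≠ 0 := fun h => hi (by rw [h, smul_zero])
    refine Set.mem_iUnion.2 ⟨i, subset_tsupport _ h1, ?_⟩
    have := support_moll_subset ρ (-b i) (subset_tsupport φ) h2
    rwa [neg_neg] at this
  refine ⟨ContDiff.sum fun i _ => (hζ i).smul
    (contDiff_moll ρ _ hφ.1.continuous.locallyIntegrable), ?_, hsupp.trans hKΩ⟩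
  exact hK.of_isClosed_subset (isClosed_tsupport _) hsupp

theorem frob_sum_smul_le {s : ℝ≥0∞} [Fact (1 ≤ s)] {c : ι → ℝ} (hc : ∀ i, 0 ≤ c i)
    (hsum : ∑ i, c i ≤ 1) {w : ι → Mat m} (hw : ∀ i, frob s (w i) ≤ 1) :
    frob s (∑ i, c i • w i) ≤ 1 := by
  rw [frob_eq_norm, map_sum]
  refine (norm_sum_le _ _).trans ((Finset.sum_le_sum fun i _ => ?_).trans hsum)
  rw [← frob_eq_norm, frob_smul, abs_of_nonneg (hc i)]
  exact mul_le_of_le_one_right (hc i) (hw i)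

theorem norm_le_sum_abs {κ : Type} [Fintype κ] (w : EuclideanSpace ℝ κ) : ‖w‖ ≤ ∑ j, |w j| := by
  classical
  have h := (EuclideanSpace.basisFun κ ℝ).sum_repr w
  calc ‖w‖ = ‖∑ j, (EuclideanSpace.basisFun κ ℝ).repr w j • EuclideanSpace.basisFun κ ℝ j‖ := by
        rw [h]
    _ ≤ ∑ j, ‖(EuclideanSpace.basisFun κ ℝ).repr w j • EuclideanSpace.basisFun κ ℝ j‖ :=
        norm_sum_le _ _
    _ = ∑ j, |w j| := by simp [norm_smul]

theorem norm_L2_le_sum (f : L2 Ω (Vec m)) :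
    ‖f‖ ≤ ∑ n, (eLpNorm (fun x => f x n) 2 (volume.restrict Ω)).toReal := by
  rw [Lp.norm_def, ← ENNReal.toReal_sum fun n _ => (memLp_apply f n).2.ne]
  refine ENNReal.toReal_mono (ENNReal.sum_ne_top.2 fun n _ => (memLp_apply f n).2.ne) ?_
  have h1 : eLpNorm f 2 (volume.restrict Ω)
      ≤ eLpNorm (∑ n, fun x => |f x n|) 2 (volume.restrict Ω) := by
    refine eLpNorm_mono_real fun x => ?_
    rw [Finset.sum_apply]
    exact norm_le_sum_abs (f x)
  refine h1.trans ((eLpNorm_sum_le (fun n _ => (memLp_apply f n).1.norm) (by norm_num)).trans ?_)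
  refine Finset.sum_le_sum fun n _ => le_of_eq ?_
  exact eLpNorm_norm (fun x => f x n)

variable {ζ : ι → Pt → ℝ} {v : L2 Ω (Vec m)} {b : ι → Pt} {ρ : ContDiffBump (0 : Pt)} {δ : ℝ}

theorem sum_zeroExt (hsum : ∀ x ∈ Ω, ∑ i, ζ i x = 1) (n : Fin m) {x : Pt} (hx : x ∈ Ω) :
    ∑ i, zeroExt v n (ζ i) x = v x n := by
  simp only [zeroExt, Set.indicator_of_mem hx]
  rw [← Finset.sum_mul, hsum x hx, one_mul]

/-- Near a point of the open set `Ω` the sum of the `ζ i` is constant, so its derivatives cancel.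
This cancellation is what makes the commutator small. -/
theorem sum_zeroExt_pd (hΩ : IsOpen Ω) (hζ : ∀ i, ContDiff ℝ ∞ (ζ i))
    (hsum : ∀ x ∈ Ω, ∑ i, ζ i x = 1) (n : Fin m) (k : Fin 2) (x : Pt) :
    ∑ i, zeroExt v n (pd k (ζ i)) x = 0 := by
  by_cases hx : x ∈ Ω
  · simp only [zeroExt, Set.indicator_of_mem hx]
    rw [← Finset.sum_mul, ← pd_sum hζ]
    have h1 : (fun y => ∑ i, ζ i y) =ᶠ[𝓝 x] fun _ => (1 : ℝ) :=
      (hΩ.eventually_mem hx).mono hsum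
    rw [pd, h1.fderiv_eq]
    simp
  · simp [zeroExt, hx]

/-- The components of the approximation of `v` by averages over inward translates. -/
def inwardAverage (ζ : ι → Pt → ℝ) (v : L2 Ω (Vec m)) (b : ι → Pt) (ρ : ContDiffBump (0 : Pt))
    (n : Fin m) (x : Pt) : ℝ :=
  ∑ i, moll ρ (b i) (zeroExt v n (ζ i)) x

theorem contDiff_inwardAverage (hΩ : IsOpen Ω) (hbdd : Bornology.IsBounded Ω)
    (hζ : ∀ i, ContDiff ℝ ∞ (ζ i)) (n : Fin m) : ContDiff ℝ ∞ (inwardAverage ζ v b ρ n) :=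
  ContDiff.sum fun i _ => contDiff_moll ρ _
    (integrable_zeroExt v n hΩ hbdd (hζ i).continuous).locallyIntegrable

theorem eLpNorm_sum_moll_sub_le (hδ : 0 ≤ δ) {F : ι → Pt → ℝ}
    (hF : ∀ i, LocallyIntegrable (F i) volume) (hm : ∀ i, Measurable (F i))
    (h : ∀ i, eLpNorm (fun x => moll ρ (b i) (F i) x - F i x) 2 volume ≤ ENNReal.ofReal δ) :
    (eLpNorm (fun x => ∑ i, (moll ρ (b i) (F i) x - F i x)) 2 (volume.restrict Ω)).toReal
      ≤ Fintype.card ι * δ := by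
  refine ENNReal.toReal_le_of_le_ofReal (by positivity) ?_
  refine (eLpNorm_mono_measure _ Measure.restrict_le_self).trans ?_
  have e : (fun x => ∑ i, (moll ρ (b i) (F i) x - F i x))
      = ∑ i, fun x => moll ρ (b i) (F i) x - F i x := by
    ext x; simp
  rw [e]
  refine (eLpNorm_sum_le (fun i _ => ?_) (by norm_num)).trans
    ((Finset.sum_le_sum fun i _ => h i).trans ?_)
  · exact ((contDiff_moll ρ (b i) (hF i)).continuous.measurable.sub (hm i)).aestronglyMeasurable
  · rw [Finset.sum_const, Finset.card_univ, nsmul_eq_mul, ENNReal.ofReal_mul (by positivity),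
      ENNReal.ofReal_natCast]

theorem norm_inwardAverage_sub_le (hΩ : IsOpen Ω) (hbdd : Bornology.IsBounded Ω)
    (hζ : ∀ i, ContDiff ℝ ∞ (ζ i)) (hsum : ∀ x ∈ Ω, ∑ i, ζ i x = 1) (hδ : 0 ≤ δ)
    (h : ∀ i n, eLpNorm (fun x => moll ρ (b i) (zeroExt v n (ζ i)) x - zeroExt v n (ζ i) x) 2 volume
      ≤ ENNReal.ofReal δ) {f : L2 Ω (Vec m)}
    (hf : ∀ᵐ x ∂(volume.restrict Ω), ∀ n, f x n = inwardAverage ζ v b ρ n x) :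
    ‖f - v‖ ≤ m * (Fintype.card ι * δ) := by
  refine (norm_L2_le_sum _).trans ?_
  have : ∀ n : Fin m, (eLpNorm (fun x => (f - v : L2 Ω (Vec m)) x n) 2
      (volume.restrict Ω)).toReal ≤ Fintype.card ι * δ := by
    intro n
    refine le_of_eq_of_le ?_ (eLpNorm_sum_moll_sub_le (Ω := Ω) hδ
      (fun i => (integrable_zeroExt v n hΩ hbdd (hζ i).continuous).locallyIntegrable)
      (fun i => measurable_zeroExt v n hΩ (hζ i).continuous) fun i => h i n)
    congr 1
    refine eLpNorm_congr_ae ?_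
    filter_upwards [hf, Lp.coeFn_sub f v, ae_restrict_mem hΩ.measurableSet] with x h1 h2 h3
    rw [h2, Pi.sub_apply, PiLp.sub_apply, h1 n, Finset.sum_sub_distrib, sum_zeroExt hsum n h3,
      inwardAverage]
  refine (Finset.sum_le_sum fun n _ => this n).trans (le_of_eq ?_)
  simp

/-- Integration by parts for the approximation: the commutator with the partition of unity is
small. -/
theorem integral_inwardAverage_mul_pd (hΩ : IsOpen Ω) (hbdd : Bornology.IsBounded Ω)
    (hζ : ∀ i, ContDiff ℝ ∞ (ζ i)) (hsum : ∀ x ∈ Ω, ∑ i, ζ i x = 1) (n : Fin m) (k : Fin 2)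
    {φ : Pt → ℝ} (hφ : IsTest Ω φ) :
    ∫ x in Ω, inwardAverage ζ v b ρ n x * pd k φ x
      = (∫ x in Ω, v x n * pd k (fun y => ∑ i, ζ i y * moll ρ (-b i) φ y) x)
        - ∫ x in Ω, φ x * ∑ i, (moll ρ (b i) (zeroExt v n (pd k (ζ i))) x
            - zeroExt v n (pd k (ζ i)) x) := by
  have hpc : HasCompactSupport (pd k φ) := hφ.2.1.fderiv_apply ℝ _
  have hm : ∀ i, ContDiff ℝ ∞ (moll ρ (-b i) φ) := fun i =>
    contDiff_moll ρ (-b i) hφ.1.continuous.locallyIntegrable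
  have hM : ∀ i, ContDiff ℝ ∞ (moll ρ (b i) (zeroExt v n (ζ i))) := fun i =>
    contDiff_moll ρ _ (integrable_zeroExt v n hΩ hbdd (hζ i).continuous).locallyIntegrable
  have hM' : ∀ i, ContDiff ℝ ∞ (moll ρ (b i) (zeroExt v n (pd k (ζ i)))) := fun i =>
    contDiff_moll ρ _ (integrable_zeroExt v n hΩ hbdd (continuous_pd (hζ i) k)).locallyIntegrable
  have e1 : ∫ x in Ω, inwardAverage ζ v b ρ n x * pd k φ x
      = ∑ i, ∫ x, moll ρ (b i) (zeroExt v n (ζ i)) x * pd k φ x := by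
    rw [setIntegral_eq_integral_of_forall_compl_eq_zero fun x hx => by
      rw [hφ.pd_eq_zero_of_notMem k hx, mul_zero]]
    simp only [inwardAverage, Finset.sum_mul]
    exact integral_finsetSum _ fun i _ => ((hM i).continuous.mul
      (continuous_pd hφ.1 k)).integrable_of_hasCompactSupport hpc.mul_left
  have e2 : ∫ x in Ω, v x n * pd k (fun y => ∑ i, ζ i y * moll ρ (-b i) φ y) x
      = ∑ i, ∫ x in Ω, v x n * pd k (fun y => ζ i y * moll ρ (-b i) φ y) x := by
    simp only [pd_sum (fun i => (hζ i).mul (hm i)), Finset.mul_sum]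
    refine integral_finsetSum _ fun i _ => ?_
    simp only [mul_comm (v _ n)]
    exact integrable_mul_apply v n hΩ hbdd (continuous_pd ((hζ i).mul (hm i)) k)
  -- The subtracted terms add up to zero by `sum_zeroExt_pd`. They are inserted so that every
  -- summand is a mollification error, small in `L²`.
  have e3 : ∫ x in Ω, φ x * ∑ i, (moll ρ (b i) (zeroExt v n (pd k (ζ i))) x
            - zeroExt v n (pd k (ζ i)) x)
      = ∑ i, ∫ x, moll ρ (b i) (zeroExt v n (pd k (ζ i))) x * φ x := by
    rw [setIntegral_eq_integral_of_forall_compl_eq_zero fun x hx => by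
      rw [hφ.eq_zero_of_notMem hx, zero_mul]]
    simp only [Finset.sum_sub_distrib, sum_zeroExt_pd hΩ hζ hsum, sub_zero, mul_comm (φ _),
      Finset.sum_mul]
    exact integral_finsetSum _ fun i _ => ((hM' i).continuous.mul
      hφ.1.continuous).integrable_of_hasCompactSupport hφ.2.1.mul_left
  rw [e1, e2, e3, ← Finset.sum_sub_distrib]
  exact Finset.sum_congr rfl fun i _ =>
    integral_moll_zeroExt_mul_pd v n hΩ hbdd ρ (b i) (hζ i) hφ.1 hφ.2.1 k

/-- The field `ψ` obtained from `φ` by the adjoint averages is again admissible: the weights `ζ i`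
are nonnegative with sum at most `1`. The total variation of `v` therefore controls the main term,
and Cauchy–Schwarz the `2m` commutator terms. -/
theorem integral_inner_grad_inwardAverage_le {s : ℝ≥0∞} [Fact (1 ≤ s)] (hΩ : IsOpen Ω)
    (hbdd : Bornology.IsBounded Ω) (hζ : ∀ i, ContDiff ℝ ∞ (ζ i)) (hζ0 : ∀ i x, 0 ≤ ζ i x)
    (hζ1 : ∀ x, ∑ i, ζ i x ≤ 1) (hsum : ∀ x ∈ Ω, ∑ i, ζ i x = 1)
    (hb : ∀ i, ∀ y ∈ Ω, ∀ t : Pt, ‖t‖ ≤ ρ.rOut → y + b i + t ∈ tsupport (ζ i) → y + b i + t ∈ Ω)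
    (hδ : 0 ≤ δ)
    (h : ∀ i n k, eLpNorm (fun x => moll ρ (b i) (zeroExt v n (pd k (ζ i))) x
      - zeroExt v n (pd k (ζ i)) x) 2 volume ≤ ENNReal.ofReal δ)
    (hv : totalVariation s v ≠ ⊤) {w : H1 Ω m}
    (hw : ∀ᵐ x ∂(volume.restrict Ω), ∀ n, incl Ω m w x n = inwardAverage ζ v b ρ n x)
    {φ : Pt → Mat m} (hφ : IsTest Ω φ) (hs : ∀ x, frob s (φ x) ≤ 1) :
    ∫ x in Ω, ∑ j, grad Ω m w x j * φ x j ≤ (totalVariation s v).toReal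
      + m * 2 * ((eLpNorm (fun _ => (1 : ℝ)) 2 (volume.restrict Ω)).toReal
        * (Fintype.card ι * δ)) := by
  have hfin := isFiniteMeasure_restrict_of_isBounded hbdd
  set V : ℝ := (eLpNorm (fun _ => (1 : ℝ)) 2 (volume.restrict Ω)).toReal
  set ψ : Pt → Mat m := fun x => ∑ i, ζ i x • moll ρ (-b i) φ x with hψdef
  have hψ : IsTest Ω ψ := isTest_sum_mul_moll hζ hb hφ
  have hψ1 : ∀ x, frob s (ψ x) ≤ 1 := fun x =>
    frob_sum_smul_le (fun i => hζ0 i x) (hζ1 x) fun i => frob_moll_le ρ _ zero_le_one hs x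
  have hψj : ∀ n k x, pd k ψ x (n, k)
      = pd k (fun y => ∑ i, ζ i y * moll ρ (-b i) (fun z => φ z (n, k)) y) x := by
    intro n k x
    rw [pd_apply hψ.1]
    congr 1
    ext y
    simp [hψdef, moll_apply ρ _ hφ.1.continuous.locallyIntegrable]
  set err : Fin m → Fin 2 → Pt → ℝ := fun n k x =>
    ∑ i, (moll ρ (b i) (zeroExt v n (pd k (ζ i))) x - zeroExt v n (pd k (ζ i)) x)
  have e1 : ∀ n k, ∫ x in Ω, grad Ω m w x (n, k) * φ x (n, k)
      = -(∫ x in Ω, v x n * pd k ψ x (n, k)) + ∫ x in Ω, φ x (n, k) * err n k x := by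
    intro n k
    have h1 : ∫ x in Ω, incl Ω m w x n * pd k (fun y => φ y (n, k)) x
        = - ∫ x in Ω, grad Ω m w x (n, k) * φ x (n, k) := w.2 _ (hφ.apply (n, k)) n k
    have h2 : ∫ x in Ω, incl Ω m w x n * pd k (fun y => φ y (n, k)) x
        = ∫ x in Ω, inwardAverage ζ v b ρ n x * pd k (fun y => φ y (n, k)) x :=
      integral_congr_ae (by filter_upwards [hw] with x hx; rw [hx])
    rw [h2, integral_inwardAverage_mul_pd hΩ hbdd hζ hsum n k (hφ.apply (n, k))] at h1
    simp only [hψj]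
    linarith
  have e2 : ∀ n k, ∫ x in Ω, φ x (n, k) * err n k x ≤ V * (Fintype.card ι * δ) := by
    intro n k
    have hm : ∀ i, ContDiff ℝ ∞ (moll ρ (b i) (zeroExt v n (pd k (ζ i)))) := fun i =>
      contDiff_moll ρ _ (integrable_zeroExt v n hΩ hbdd (continuous_pd (hζ i) k)).locallyIntegrable
    have hE : MemLp (err n k) 2 (volume.restrict Ω) := memLp_finsetSum _ fun i _ =>
      (memLp_restrict_of_continuous hΩ hbdd (hm i).continuous 2).sub
        ((memLp_zeroExt v n hΩ hbdd (continuous_pd (hζ i) k)).restrict Ω)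
    have hφL : MemLp (fun x => φ x (n, k)) 2 (volume.restrict Ω) :=
      memLp_restrict_of_continuous hΩ hbdd (hφ.apply (n, k)).1.continuous 2
    refine (le_abs_self _).trans ((abs_integral_mul_le_eLpNorm hφL hE).trans ?_)
    refine mul_le_mul ?_ ?_ ENNReal.toReal_nonneg ENNReal.toReal_nonneg
    · refine ENNReal.toReal_mono (memLp_const (1 : ℝ)).2.ne (eLpNorm_mono_real fun x => ?_)
      exact (abs_apply_le_frob (φ x) (n, k)).trans (hs x)
    · exact eLpNorm_sum_moll_sub_le hδ
        (fun i => (integrable_zeroExt v n hΩ hbdd (continuous_pd (hζ i) k)).locallyIntegrable)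
        (fun i => measurable_zeroExt v n hΩ (continuous_pd (hζ i) k)) fun i => h i n k
  have hint : ∀ n k, Integrable (fun x => v x n * pd k ψ x (n, k)) (volume.restrict Ω) := by
    intro n k
    simp only [pd_apply hψ.1, mul_comm (v _ n)]
    exact integrable_mul_apply v n hΩ hbdd (continuous_pd (hψ.apply (n, k)).1 k)
  have e3 : ∫ x in Ω, ∑ n, v x n * ∑ k, pd k ψ x (n, k)
      = ∑ n, ∑ k, ∫ x in Ω, v x n * pd k ψ x (n, k) := by
    simp only [Finset.mul_sum]
    rw [integral_finsetSum _ fun n _ => integrable_finsetSum _ fun k _ => hint n k]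
    exact Finset.sum_congr rfl fun n _ => integral_finsetSum _ fun k _ => hint n k
  have e4 := neg_toReal_totalVariation_le hv hψ hψ1
  rw [e3] at e4
  have hint' : ∀ j, Integrable (fun x => grad Ω m w x j * φ x j) (volume.restrict Ω) := fun j =>
    (memLp_apply (grad Ω m w) j).integrable_mul
      (memLp_restrict_of_continuous hΩ hbdd (hφ.apply j).1.continuous 2)
  rw [integral_finsetSum _ fun j _ => hint' j, Fintype.sum_prod_type]
  calc ∑ n, ∑ k, ∫ x in Ω, grad Ω m w x (n, k) * φ x (n, k)
      ≤ ∑ n, ∑ k, (-(∫ x in Ω, v x n * pd k ψ x (n, k)) + V * (Fintype.card ι * δ)) :=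
        Finset.sum_le_sum fun n _ => Finset.sum_le_sum fun k _ => by
          rw [e1]; linarith [e2 n k]
    _ = -(∑ n, ∑ k, ∫ x in Ω, v x n * pd k ψ x (n, k)) + m * 2 * (V * (Fintype.card ι * δ)) := by
        simp only [Finset.sum_add_distrib, Finset.sum_neg_distrib, Finset.sum_const,
          Finset.card_univ, Fintype.card_fin, nsmul_eq_mul]
        push_cast
        ring
    _ ≤ _ := by linarith

/-- On a bounded Lipschitz domain, functions of bounded variation are limits in `L²` of functions
in `H¹` whose variations do not exceed theirs by more than an arbitrarily small amount. -/
theorem exists_H1_approx (hΩ : IsOpen Ω) (hbdd : Bornology.IsBounded Ω)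
    (hLip : HasLipschitzBoundary Ω) {r s : ℝ≥0∞} (h : r⁻¹ + s⁻¹ = 1)
    (hv : totalVariation s v ≠ ⊤) {ε : ℝ} (hε : 0 < ε) : ∃ w : H1 Ω m, ‖incl Ω m w - v‖ ≤ ε ∧
      ∫ x in Ω, frob r (grad Ω m w x) ≤ (totalVariation s v).toReal + ε := by
  have hr : Fact (1 ≤ r) := ⟨one_le_left_of_inv_add_inv h⟩
  have hs : Fact (1 ≤ s) := ⟨one_le_left_of_inv_add_inv ((add_comm _ _).trans h)⟩
  have hfin := isFiniteMeasure_restrict_of_isBounded hbdd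
  obtain ⟨ι, _, ζ, a, hζ, hζ0, hζ1, hsum, ε₀, hε₀, hshift⟩ := exists_partition_inward hΩ hbdd hLip
  set V : ℝ := (eLpNorm (fun _ => (1 : ℝ)) 2 (volume.restrict Ω)).toReal
  have hV : 0 ≤ V := ENNReal.toReal_nonneg
  -- With tolerance `δ` for each mollification, the `L²` error is at most the first summand times
  -- `δ` and the excess variation at most the second times `δ`.
  set C : ℝ := m * Fintype.card ι + m * 2 * (V * Fintype.card ι) + 1 with hC
  have hCpos : 0 < C := by positivity
  set δ : ℝ := ε / C
  have hδ : 0 < δ := by positivity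
  have hδC : δ * C = ε := div_mul_cancel₀ _ hCpos.ne'
  choose η₁ hη₁ hconv₁ using fun (i : ι) (n : Fin m) =>
    exists_eLpNorm_moll_sub_le (measurable_zeroExt v n hΩ (hζ i).continuous)
      (memLp_zeroExt v n hΩ hbdd (hζ i).continuous) (ENNReal.ofReal_pos.2 hδ)
  choose η₂ hη₂ hconv₂ using fun (i : ι) (n : Fin m) (k : Fin 2) =>
    exists_eLpNorm_moll_sub_le (measurable_zeroExt v n hΩ (continuous_pd (hζ i) k))
      (memLp_zeroExt v n hΩ hbdd (continuous_pd (hζ i) k)) (ENNReal.ofReal_pos.2 hδ)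
  obtain ⟨e, he, he0, he1, he2⟩ : ∃ e > 0, e < ε₀ ∧ (∀ i n, e + ‖e • a i‖ < η₁ i n) ∧
      ∀ i n k, e + ‖e • a i‖ < η₂ i n k := by
    have hlim : ∀ i, Tendsto (fun e : ℝ => e + ‖e • a i‖) (𝓝[>] 0) (𝓝 0) := by
      intro i
      have : Continuous fun e : ℝ => e + ‖e • a i‖ := by fun_prop
      have h0 := this.tendsto 0
      rw [zero_smul, norm_zero, add_zero] at h0
      exact h0.mono_left nhdsWithin_le_nhds
    have h1 : ∀ᶠ e in 𝓝[>] (0 : ℝ), e < ε₀ ∧ (∀ i n, e + ‖e • a i‖ < η₁ i n) ∧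
        ∀ i n k, e + ‖e • a i‖ < η₂ i n k :=
      (eventually_nhdsWithin_of_eventually_nhds (eventually_lt_nhds hε₀)).and
        ((eventually_all.2 fun i => eventually_all.2 fun n =>
            (hlim i).eventually_lt_const (hη₁ i n)).and
          (eventually_all.2 fun i => eventually_all.2 fun n => eventually_all.2 fun k =>
            (hlim i).eventually_lt_const (hη₂ i n k)))
    obtain ⟨e, h2, h3⟩ := (h1.and self_mem_nhdsWithin).exists
    exact ⟨e, h3, h2⟩
  obtain ⟨ρ, hρ⟩ := exists_contDiffBump he
  obtain ⟨w, hw⟩ := exists_H1_of_contDiff hΩ hbdd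
    (inwardAverage ζ v (fun i => e • a i) ρ) fun n => contDiff_inwardAverage hΩ hbdd hζ n
  refine ⟨w, ?_, ?_⟩
  · refine (norm_inwardAverage_sub_le hΩ hbdd hζ hsum hδ.le (fun i n => ?_) hw).trans ?_
    · exact hconv₁ i n ρ _ (by rw [hρ]; exact he1 i n)
    · rw [← hδC, hC]
      nlinarith [mul_nonneg hδ.le (show 0 ≤ m * 2 * (V * Fintype.card ι) by positivity)]
  · refine integral_frob_le_of_forall_isTest hΩ hbdd h _ fun φ hφ hφ1 => ?_
    refine (integral_inner_grad_inwardAverage_le hΩ hbdd hζ hζ0 hζ1 hsum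
      (fun i y hy t ht hmem => hshift i e he he0 y hy t (by rwa [← hρ]) hmem) hδ.le
      (fun i n k => hconv₂ i n k ρ _ (by rw [hρ]; exact he2 i n k)) hv hw hφ hφ1).trans ?_
    rw [← hδC, hC]
    nlinarith [mul_nonneg hδ.le (show (0 : ℝ) ≤ m * Fintype.card ι by positivity)]

end Relaxation

/-! ## Strong convexity of the primal energy -/

section Energy

open Filter Topology

variable {Ω : Set Pt} {m : ℕ}

theorem L2.inner_eq_setIntegral_mul (f h : L2 Ω ℝ) : ⟪f, h⟫ = ∫ x in Ω, f x * h x := by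
  rw [MeasureTheory.L2.inner_def]
  simp [mul_comm]

/-- Weak gradients are unique. -/
theorem incl_injective (hΩ : IsOpen Ω) : Function.Injective (incl Ω m) := by
  refine (injective_iff_map_eq_zero _).2 fun w hw => ?_
  have hG : grad Ω m w = 0 := by
    have h1 : ∀ n k, ∀ᵐ x ∂(volume.restrict Ω), grad Ω m w x (n, k) = 0 := by
      intro n k
      refine (ae_restrict_iff' hΩ.measurableSet).2 ?_
      refine hΩ.ae_eq_zero_of_integral_contDiff_smul_eq_zero ?_ fun φ hφ hc hs => ?_
      · have : LocallyIntegrable (fun x => grad Ω m w x (n, k)) (volume.restrict Ω) :=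
          (memLp_apply (grad Ω m w) (n, k)).locallyIntegrable (by norm_num)
        exact locallyIntegrableOn_of_locallyIntegrable_restrict this
      · have h2 : ∫ x in Ω, incl Ω m w x n * pd k φ x
            = - ∫ x in Ω, grad Ω m w x (n, k) * φ x := w.2 φ ⟨hφ, hc, hs⟩ n k
        have h3 : ∫ x in Ω, incl Ω m w x n * pd k φ x = 0 := by
          refine integral_eq_zero_of_ae ?_
          rw [hw]
          filter_upwards [Lp.coeFn_zero (Vec m) 2 (volume.restrict Ω)] with x hx
          rw [hx]; simp
        rw [← setIntegral_eq_integral_of_forall_compl_eq_zero (s := Ω) fun x hx => by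
          rw [IsTest.eq_zero_of_notMem ⟨hφ, hc, hs⟩ hx, zero_smul]]
        simp only [smul_eq_mul, mul_comm (φ _)]
        linarith
    refine Lp.ext ?_
    filter_upwards [ae_all_iff.2 fun n => ae_all_iff.2 (h1 n),
      Lp.coeFn_zero (Mat m) 2 (volume.restrict Ω)] with x hx h0
    rw [h0]
    ext ⟨n, k⟩
    exact hx n k
  refine Subtype.ext ((WithLp.ofLp_injective 2) (Prod.ext hw hG))

variable {g : L2 Ω ℝ} {α₁ α₂ β lam : ℝ} {r s : ℝ≥0∞} {T : L2 Ω (Vec m) →L[ℝ] L2 Ω ℝ} {S : Reg}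

theorem extEnergy_incl (hΩ : IsOpen Ω) (w : H1 Ω m) :
    extEnergy g α₁ α₂ β lam r s T S (incl Ω m w) = (primalEnergy g α₁ α₂ β lam r T S w : ℝ) := by
  have h : ∃ w' : H1 Ω m, incl Ω m w' = incl Ω m w := ⟨w, rfl⟩
  rw [extEnergy, dif_pos h, incl_injective hΩ h.choose_spec]

theorem sNormSqExt_incl (hΩ : IsOpen Ω) (w : H1 Ω m) :
    sNormSqExt S (incl Ω m w) = ENNReal.ofReal (sNormSq S w) := by
  cases S with
  | id => rfl
  | grad =>
    have h : ∃ w' : H1 Ω m, incl Ω m w' = incl Ω m w := ⟨w, rfl⟩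
    rw [sNormSqExt, dif_pos h, incl_injective hΩ h.choose_spec, sNormSq]

theorem sNormSq_nonneg (w : H1 Ω m) : 0 ≤ sNormSq S w := by
  cases S <;> exact sq_nonneg _

theorem bNormSq_incl (hΩ : IsOpen Ω) (hβ : 0 ≤ β) (w : H1 Ω m) :
    bNormSq α₂ β T S (incl Ω m w)
      = (α₂ * ‖T (incl Ω m w)‖ ^ 2 + β * sNormSq S w : ℝ) := by
  rw [bNormSq, sNormSqExt_incl hΩ, ← ENNReal.ofReal_mul hβ,
    EReal.coe_ennreal_ofReal, max_eq_left (mul_nonneg hβ (sNormSq_nonneg w)), EReal.coe_add]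

theorem norm_sq_convex_comb {V : Type} [NormedAddCommGroup V] [InnerProductSpace ℝ V] (a b : V)
    (t : ℝ) : ‖(1 - t) • a + t • b‖ ^ 2
      = (1 - t) * ‖a‖ ^ 2 + t * ‖b‖ ^ 2 - t * (1 - t) * ‖b - a‖ ^ 2 := by
  simp only [← real_inner_self_eq_norm_sq, inner_add_left, inner_add_right, inner_sub_left,
    inner_sub_right, real_inner_smul_left, real_inner_smul_right, real_inner_comm a b]
  ring

theorem sNormSq_convex_comb (a b : H1 Ω m) (t : ℝ) : sNormSq S ((1 - t) • a + t • b)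
    = (1 - t) * sNormSq S a + t * sNormSq S b - t * (1 - t) * sNormSq S (b - a) := by
  cases S <;> simp only [sNormSq, map_add, map_sub, map_smul, norm_sq_convex_comb]

theorem integral_convex_comb_le {F : Type} [NormedAddCommGroup F] [NormedSpace ℝ F] {ν : F → ℝ}
    (hν : ConvexOn ℝ Set.univ ν)
    (hi : ∀ f : L2 Ω F, Integrable (fun x => ν (f x)) (volume.restrict Ω)) (a b : L2 Ω F) {t : ℝ}
    (h0 : 0 ≤ t) (h1 : t ≤ 1) : ∫ x in Ω, ν (((1 - t) • a + t • b : L2 Ω F) x)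
      ≤ (1 - t) * (∫ x in Ω, ν (a x)) + t * ∫ x in Ω, ν (b x) := by
  rw [← integral_const_mul, ← integral_const_mul,
    ← integral_add ((hi a).const_mul _) ((hi b).const_mul _)]
  refine integral_mono_ae (hi _) (((hi a).const_mul _).add ((hi b).const_mul _)) ?_
  filter_upwards [Lp.coeFn_add ((1 - t) • a) (t • b), Lp.coeFn_smul (1 - t) a,
    Lp.coeFn_smul t b] with x hx ha hb
  rw [hx, Pi.add_apply, ha, hb]
  exact hν.2 (Set.mem_univ _) (Set.mem_univ _) (by linarith) h0 (by ring)

theorem convexOn_frob [Fact (1 ≤ r)] : ConvexOn ℝ Set.univ (frob r : Mat m → ℝ) := by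
  refine ⟨convex_univ, fun v _ w _ a b ha hb _ => (frob_add_le _ _).trans ?_⟩
  rw [frob_smul, frob_smul, abs_of_nonneg ha, abs_of_nonneg hb]
  rfl

theorem convexOn_abs : ConvexOn ℝ Set.univ fun x : ℝ => |x| :=
  convexOn_univ_norm (E := ℝ)

variable [IsFiniteMeasure (volume.restrict Ω)]

theorem integrable_abs (f : L2 Ω ℝ) : Integrable (fun x => |f x|) (volume.restrict Ω) :=
  ((Lp.memLp f).integrable (by norm_num)).norm

/-- The squared norms obey an exact identity along segments, which yields the subtracted term; the
two integrals contribute only convexity. -/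
theorem primalEnergy_convex_comb_le [Fact (1 ≤ r)] (hα₁ : 0 ≤ α₁) (hlam : 0 ≤ lam) (a b : H1 Ω m)
    {t : ℝ} (h0 : 0 ≤ t) (h1 : t ≤ 1) :
    primalEnergy g α₁ α₂ β lam r T S ((1 - t) • a + t • b)
      ≤ (1 - t) * primalEnergy g α₁ α₂ β lam r T S a + t * primalEnergy g α₁ α₂ β lam r T S b
        - t * (1 - t) * (1 / 2 * (α₂ * ‖T (incl Ω m (b - a))‖ ^ 2 + β * sNormSq S (b - a))) := by
  have e1 : T (incl Ω m ((1 - t) • a + t • b)) - g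
      = (1 - t) • (T (incl Ω m a) - g) + t • (T (incl Ω m b) - g) := by
    rw [map_add, map_smul, map_smul, map_add, map_smul, map_smul]
    module
  have e2 : T (incl Ω m (b - a)) = (T (incl Ω m b) - g) - (T (incl Ω m a) - g) := by
    simp only [map_sub]; abel
  have h2 := integral_convex_comb_le convexOn_abs integrable_abs (T (incl Ω m a) - g)
    (T (incl Ω m b) - g) h0 h1
  have h3 := integral_convex_comb_le (convexOn_frob (r := r)) integrable_frob (grad Ω m a)
    (grad Ω m b) h0 h1
  have h4 := mul_le_mul_of_nonneg_left h2 hα₁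
  have h5 := mul_le_mul_of_nonneg_left h3 hlam
  simp only [primalEnergy, e1, e2, norm_sq_convex_comb, sNormSq_convex_comb,
    map_add (grad Ω m), map_smul (grad Ω m)]
  linarith

/-- Minimality is tested at the point `(1 - t) • u + t • w`; the inequality is divided by `t`, and
`t` tends to `0`. -/
theorem IsPrimalSolution.half_sq_le [Fact (1 ≤ r)] (hα₁ : 0 ≤ α₁) (hlam : 0 ≤ lam) {u : H1 Ω m}
    (hu : IsPrimalSolution g α₁ α₂ β lam r T S u) (w : H1 Ω m) :
    1 / 2 * (α₂ * ‖T (incl Ω m (w - u))‖ ^ 2 + β * sNormSq S (w - u))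
      ≤ primalEnergy g α₁ α₂ β lam r T S w - primalEnergy g α₁ α₂ β lam r T S u := by
  set Q : ℝ := 1 / 2 * (α₂ * ‖T (incl Ω m (w - u))‖ ^ 2 + β * sNormSq S (w - u)) with hQ
  have key : ∀ t ∈ Set.Ioo (0 : ℝ) 1, (1 - t) * Q
      ≤ primalEnergy g α₁ α₂ β lam r T S w - primalEnergy g α₁ α₂ β lam r T S u := by
    intro t ht
    have h1 := primalEnergy_convex_comb_le (g := g) (α₂ := α₂) (β := β) (r := r) (T := T) (S := S)
      hα₁ hlam u w ht.1.le ht.2.le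
    have h2 := hu ((1 - t) • u + t • w)
    rw [← hQ] at h1
    refine le_of_mul_le_mul_left ?_ ht.1
    linarith
  have hlim : Tendsto (fun t : ℝ => (1 - t) * Q) (𝓝[>] 0) (𝓝 Q) := by
    have : Continuous fun t : ℝ => (1 - t) * Q := by fun_prop
    have h0 := this.tendsto 0
    rw [sub_zero, one_mul] at h0
    exact h0.mono_left nhdsWithin_le_nhds
  exact le_of_tendsto hlim (Filter.mem_of_superset (Ioo_mem_nhdsGT one_pos) key)

theorem continuous_integral_abs : Continuous fun f : L2 Ω ℝ => ∫ x in Ω, |f x| := by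
  set V : ℝ := (eLpNorm (fun _ => (1 : ℝ)) 2 (volume.restrict Ω)).toReal
  refine (LipschitzWith.of_le_add_mul (K := V.toNNReal) fun f h => ?_).continuous
  have h1 : ∫ x in Ω, |(f - h : L2 Ω ℝ) x| ≤ V * ‖f - h‖ := by
    have := abs_integral_mul_le_eLpNorm (memLp_const (1 : ℝ)) (Lp.memLp (f - h)).norm
    rw [eLpNorm_norm] at this
    simp only [one_mul, Real.norm_eq_abs] at this
    exact (le_abs_self _).trans this
  rw [Real.coe_toNNReal _ ENNReal.toReal_nonneg, dist_eq_norm]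
  refine le_trans ?_ (add_le_add_right h1 _)
  rw [← integral_add (integrable_abs h) (integrable_abs (f - h))]
  refine integral_mono_ae (integrable_abs f) ((integrable_abs h).add (integrable_abs (f - h))) ?_
  filter_upwards [Lp.coeFn_sub f h] with x hx
  rw [hx, Pi.sub_apply]
  have := abs_add_le (h x) (f x - h x)
  rwa [add_sub_cancel] at this

/-- The growth of the energy away from its minimizer, for functions of bounded variation and a
regularization of order zero. -/
theorem IsPrimalSolution.half_sq_le_of_totalVariation_ne_top (hΩ : IsOpen Ω)
    (hbdd : Bornology.IsBounded Ω) (hLip : HasLipschitzBoundary Ω) (hrs : r⁻¹ + s⁻¹ = 1)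
    (hα₁ : 0 ≤ α₁) (hlam : 0 ≤ lam) {u : H1 Ω m} (hu : IsPrimalSolution g α₁ α₂ β lam r T S u)
    {γ : ℝ} (hγ : ∀ w : H1 Ω m, β * sNormSq S w = γ * ‖incl Ω m w‖ ^ 2) {v : L2 Ω (Vec m)}
    (hv : totalVariation s v ≠ ⊤) :
    1 / 2 * (α₂ * ‖T (v - incl Ω m u)‖ ^ 2 + γ * ‖v - incl Ω m u‖ ^ 2)
      ≤ α₁ * (∫ x in Ω, |(T v - g : L2 Ω ℝ) x|) + α₂ / 2 * ‖T v - g‖ ^ 2 + γ / 2 * ‖v‖ ^ 2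
        + lam * (totalVariation s v).toReal - primalEnergy g α₁ α₂ β lam r T S u := by
  have : Fact (1 ≤ r) := ⟨one_le_left_of_inv_add_inv hrs⟩
  -- `Ψ` gathers everything that is continuous in `L²`, including the quadratic growth term with its
  -- sign reversed. The variation is the only other term, and `hw2` bounds it along the
  -- approximating sequence.
  set Ψ : L2 Ω (Vec m) → ℝ := fun z => α₁ * (∫ x in Ω, |(T z - g : L2 Ω ℝ) x|)
    + α₂ / 2 * ‖T z - g‖ ^ 2 + γ / 2 * ‖z‖ ^ 2
    - 1 / 2 * (α₂ * ‖T (z - incl Ω m u)‖ ^ 2 + γ * ‖z - incl Ω m u‖ ^ 2) with hΨ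
  have hcont : Continuous Ψ := by
    have := continuous_integral_abs.comp (T.continuous.sub (continuous_const (y := g)))
    have h' : Continuous fun z => ∫ x in Ω, |(T z - g : L2 Ω ℝ) x| := this
    fun_prop
  choose w hw1 hw2 using fun k : ℕ => exists_H1_approx hΩ hbdd hLip hrs hv
    (Nat.one_div_pos_of_nat (α := ℝ) (n := k))
  have hlim0 : Tendsto (fun k : ℕ => 1 / ((k : ℝ) + 1)) atTop (𝓝 0) :=
    tendsto_one_div_add_atTop_nhds_zero_nat
  have hlim1 : Tendsto (fun k => incl Ω m (w k)) atTop (𝓝 v) :=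
    tendsto_iff_norm_sub_tendsto_zero.2 (squeeze_zero (fun _ => norm_nonneg _) hw1 hlim0)
  have hlim2 : Tendsto (fun k : ℕ => Ψ (incl Ω m (w k))
      + lam * ((totalVariation s v).toReal + 1 / ((k : ℝ) + 1))) atTop
      (𝓝 (Ψ v + lam * ((totalVariation s v).toReal + 0))) :=
    ((hcont.tendsto v).comp hlim1).add ((tendsto_const_nhds.add hlim0).const_mul lam)
  have hge : primalEnergy g α₁ α₂ β lam r T S u
      ≤ Ψ v + lam * ((totalVariation s v).toReal + 0) := by
    refine ge_of_tendsto' hlim2 fun k => ?_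
    have h1 := hu.half_sq_le hα₁ hlam (w k)
    have h2 := mul_le_mul_of_nonneg_left (hw2 k) hlam
    have h3 := hγ (w k)
    rw [hγ, map_sub] at h1
    simp only [primalEnergy] at h1 ⊢
    simp only [hΨ]
    linarith
  simp only [hΨ] at hge
  linarith

end Energy

/-! ## Weak duality -/

section Duality

variable {Ω : Set Pt} {m : ℕ} {g : L2 Ω ℝ} {α₁ α₂ β lam : ℝ} {r s : ℝ≥0∞}
  {T : L2 Ω (Vec m) →L[ℝ] L2 Ω ℝ} {S : Reg}

theorem normalOp_apply {V W : Type} [NormedAddCommGroup V] [InnerProductSpace ℝ V]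
    [NormedAddCommGroup W] [InnerProductSpace ℝ W] (A : V →L[ℝ] L2 Ω ℝ) (Sg : V →L[ℝ] W) (x y : V) :
    normalOp α₂ β A Sg x y = α₂ * ⟪A x, A y⟫ + β * ⟪Sg x, Sg y⟫ := rfl

/-- Completing the square: with `w = B⁻¹ f`, the difference of the two sides is half the value of
the nonnegative form of `B` at `z + w`. -/
theorem normalOp_inverse_le {V W : Type} [NormedAddCommGroup V] [InnerProductSpace ℝ V]
    [NormedAddCommGroup W] [InnerProductSpace ℝ W] (hα₂ : 0 ≤ α₂) (hβ : 0 ≤ β)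
    {A : V →L[ℝ] L2 Ω ℝ} {Sg : V →L[ℝ] W} (hB : (normalOp α₂ β A Sg).IsInvertible)
    (f : StrongDual ℝ V) (z : V) :
    -(1 / 2) * f ((normalOp α₂ β A Sg).inverse f)
      ≤ f z + 1 / 2 * (α₂ * ‖A z‖ ^ 2 + β * ‖Sg z‖ ^ 2) := by
  set B := normalOp α₂ β A Sg
  set w := B.inverse f
  have hf : f = B w := (hB.self_apply_inverse f).symm
  have h1 : 0 ≤ α₂ * ‖A (z + w)‖ ^ 2 + β * ‖Sg (z + w)‖ ^ 2 := by positivity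
  rw [hf, normalOp_apply, normalOp_apply]
  simp only [← real_inner_self_eq_norm_sq, map_add, inner_add_left, inner_add_right,
    real_inner_comm (A w) (A z), real_inner_comm (Sg w) (Sg z)] at h1 ⊢
  linarith

/-- The bound holds for every extension `f` of `ℓ`, as `f (j u) = ℓ u`. Without an extension the
infimum is `⊤`. -/
theorem le_invSq {V W : Type} [NormedAddCommGroup V] [InnerProductSpace ℝ V]
    [NormedAddCommGroup W] [InnerProductSpace ℝ W] (hα₂ : 0 ≤ α₂) (hβ : 0 ≤ β)
    {A : V →L[ℝ] L2 Ω ℝ} {Sg : V →L[ℝ] W} (hB : (normalOp α₂ β A Sg).IsInvertible)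
    (j : H1 Ω m →L[ℝ] V) (ℓ : StrongDual ℝ (H1 Ω m)) (u : H1 Ω m) :
    ((-2 * (ℓ u + 1 / 2 * (α₂ * ‖A (j u)‖ ^ 2 + β * ‖Sg (j u)‖ ^ 2)) : ℝ) : EReal)
      ≤ invSq (normalOp α₂ β A Sg) j ℓ := by
  refine le_iInf₂ fun f hf => EReal.coe_le_coe_iff.2 ?_
  have h1 := normalOp_inverse_le hα₂ hβ hB f (j u)
  have h2 : f (j u) = ℓ u := by rw [← hf]; rfl
  rw [h2] at h1
  linarith

theorem le_bInvNormSq (hα₂ : 0 ≤ α₂) (hβ : 0 ≤ β) (hB : BInvertible α₂ β T S)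
    (ℓ : StrongDual ℝ (H1 Ω m)) (u : H1 Ω m) :
    ((-2 * (ℓ u + 1 / 2 * (α₂ * ‖T (incl Ω m u)‖ ^ 2 + β * sNormSq S u)) : ℝ) : EReal)
      ≤ bInvNormSq α₂ β T S ℓ := by
  unfold BInvertible at hB
  unfold bInvNormSq
  split_ifs at hB ⊢ with h
  · have h1 := le_invSq hα₂ hβ hB (incl Ω m) ℓ u
    -- For `β = 0` the choice of `S` is immaterial, so the identity may stand in for it.
    have h2 : β * sNormSq S u = β * ‖incl Ω m u‖ ^ 2 := by
      rcases h with rfl | rfl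
      · rfl
      · simp
    rw [h2]
    exact h1
  · push Not at h
    obtain rfl : S = .grad := by
      cases S
      · exact absurd rfl h.1
      · rfl
    exact le_invSq hα₂ hβ hB (ContinuousLinearMap.id ℝ (H1 Ω m)) ℓ u

theorem dualResidual_apply (p₁ : L2 Ω ℝ) (p₂ : L2 Ω (Mat m)) (u : H1 Ω m) :
    dualResidual g α₂ T p₁ p₂ u
      = ⟪p₁, T (incl Ω m u)⟫ + ⟪p₂, grad Ω m u⟫ - α₂ * ⟪g, T (incl Ω m u)⟫ := by
  change ⟪ContinuousLinearMap.adjoint T p₁, incl Ω m u⟫ + ⟪p₂, grad Ω m u⟫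
    - α₂ * ⟪ContinuousLinearMap.adjoint T g, incl Ω m u⟫ = _
  rw [ContinuousLinearMap.adjoint_inner_left, ContinuousLinearMap.adjoint_inner_left]

variable [IsFiniteMeasure (volume.restrict Ω)]

theorem inner_le_mul_integral_abs {p f : L2 Ω ℝ}
    (hp : ∀ᵐ x ∂(volume.restrict Ω), |p x| ≤ α₁) : ⟪p, f⟫ ≤ α₁ * ∫ x in Ω, |f x| := by
  rw [L2.inner_eq_setIntegral_mul, ← integral_const_mul]
  refine integral_mono_ae ((Lp.memLp p).integrable_mul (Lp.memLp f))
    ((integrable_abs f).const_mul _) ?_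
  filter_upwards [hp] with x hx
  refine (le_abs_self (p x * f x)).trans ?_
  rw [abs_mul]
  exact mul_le_mul_of_nonneg_right hx (abs_nonneg (f x))

theorem inner_le_mul_integral_frob [Fact (1 ≤ r)] (hrs : r⁻¹ + s⁻¹ = 1) {p f : L2 Ω (Mat m)}
    (hp : ∀ᵐ x ∂(volume.restrict Ω), frob s (p x) ≤ lam) :
    ⟪p, f⟫ ≤ lam * ∫ x in Ω, frob r (f x) := by
  rw [L2.inner_def, ← integral_const_mul]
  refine integral_mono_ae (L2.integrable_inner (𝕜 := ℝ) p f)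
    ((integrable_frob f).const_mul _) ?_
  filter_upwards [hp] with x hx
  rw [real_inner_comm, mul_comm]
  exact (inner_le_frob_mul_frob hrs _ _).trans
    (mul_le_mul_of_nonneg_left hx (frob_nonneg _))

/-- Weak duality: the energy is at least the dual energy, here solved for the residual. -/
theorem le_bInvNormSq_dualResidual [Fact (1 ≤ r)] (hrs : r⁻¹ + s⁻¹ = 1) (hα₂ : 0 ≤ α₂)
    (hβ : 0 ≤ β) (hB : BInvertible α₂ β T S) {p₁ : L2 Ω ℝ} {p₂ : L2 Ω (Mat m)}
    (hp₁ : ∀ᵐ x ∂(volume.restrict Ω), |p₁ x| ≤ α₁)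
    (hp₂ : ∀ᵐ x ∂(volume.restrict Ω), frob s (p₂ x) ≤ lam) (u : H1 Ω m) :
    ((2 * (α₂ / 2 * ‖g‖ ^ 2 - ⟪g, p₁⟫ - primalEnergy g α₁ α₂ β lam r T S u) : ℝ) : EReal)
      ≤ bInvNormSq α₂ β T S (dualResidual g α₂ T p₁ p₂) := by
  refine le_trans (EReal.coe_le_coe_iff.2 ?_) (le_bInvNormSq hα₂ hβ hB _ u)
  -- Pairing `p₁` with `T u - g` rather than `T u` produces the term `⟪g, p₁⟫`; the mixed term of
  -- `‖T u - g‖²` cancels the `g` part of the residual.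
  have h1 := inner_le_mul_integral_abs (f := T (incl Ω m u) - g) hp₁
  have h2 := inner_le_mul_integral_frob (r := r) hrs (f := grad Ω m u) hp₂
  have h3 := norm_sub_sq_real (T (incl Ω m u)) g
  rw [inner_sub_right, real_inner_comm g p₁] at h1
  rw [real_inner_comm] at h3
  rw [dualResidual_apply, primalEnergy, h3]
  linarith

end Duality

/-! ## Piecewise constant interpolation -/

namespace SquareGrid

variable {Ω : Set Pt} {N m : ℕ} (G : SquareGrid Ω N)

theorem measurableSet_cell (i : Fin N) : MeasurableSet (G.cell i) :=
  (isOpen_square _ _).measurableSet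

theorem volume_cell (i : Fin N) : volume.real (G.cell i) = G.side i ^ 2 := by
  have hs : G.cell i = (MeasurableEquiv.toLp 2 (Fin 2 → ℝ)).symm ⁻¹'
      (Set.univ.pi fun k => Set.Ioo (G.center i k - G.side i / 2) (G.center i k + G.side i / 2)) := by
    ext y
    simp only [cell, square, Set.mem_ofPred_eq, Set.mem_preimage, Set.mem_univ_pi, Set.mem_Ioo,
      abs_lt]
    refine forall_congr' fun k => ?_
    change _ ↔ _ < y k ∧ y k < _
    constructor <;> rintro ⟨h1, h2⟩ <;> constructor <;> linarith
  have h := G.side_pos i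
  rw [Measure.real, hs, (EuclideanSpace.volume_preserving_symm_measurableEquiv_toLp
    (Fin 2)).measure_preimage_equiv, Real.volume_pi_Ioo, ENNReal.toReal_prod]
  simp only [Fin.prod_univ_two]
  rw [ENNReal.toReal_ofReal (by linarith), ENNReal.toReal_ofReal (by linarith)]
  ring

theorem coeFn_interp {F : Type} [NormedAddCommGroup F] (v : Fin N → F) :
    ∀ᵐ x ∂(volume.restrict Ω), G.interp v x = ∑ i, (G.cell i).indicator (fun _ => v i) x := by
  have h1 := Lp.coeFn_finsetSum Finset.univ fun i => indicatorConstLp 2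
    (isOpen_square (G.center i) (G.side i)).measurableSet
    (volume_square_ne_top Ω (G.center i) (G.side i)) (v i)
  filter_upwards [h1, ae_all_iff.2 fun i => indicatorConstLp_coeFn
    (hs := (isOpen_square (G.center i) (G.side i)).measurableSet)
    (hμs := volume_square_ne_top Ω (G.center i) (G.side i)) (c := v i) (p := 2)] with x hx hi
  rw [interp, hx, Finset.sum_apply]
  exact Finset.sum_congr rfl fun i _ => hi i

theorem sum_indicator_of_mem {F : Type} [AddCommMonoid F] (v : Fin N → F) {i : Fin N} {x : Pt}
    (hx : x ∈ G.cell i) : ∑ j, (G.cell j).indicator (fun _ => v j) x = v i := by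
  rw [Finset.sum_eq_single i, Set.indicator_of_mem hx]
  · intro j _ hj
    exact Set.indicator_of_notMem
      (fun hxj => Set.disjoint_left.1 (G.disjoint j i hj) hxj hx) _
  · simp

/-- The representative takes only the values `v i` and, outside the open cells, `0`. Assuming `P 0`
avoids showing that the cell boundaries are null sets. -/
theorem interp_mem {F : Type} [NormedAddCommGroup F] {v : Fin N → F} {P : F → Prop} (h0 : P 0)
    (h : ∀ i, P (v i)) : ∀ᵐ x ∂(volume.restrict Ω), P (G.interp v x) := by
  filter_upwards [G.coeFn_interp v] with x hx
  rw [hx]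
  by_cases hc : ∃ i, x ∈ G.cell i
  · obtain ⟨i, hi⟩ := hc
    rw [G.sum_indicator_of_mem v hi]
    exact h i
  · push Not at hc
    rwa [Finset.sum_eq_zero fun i _ => Set.indicator_of_notMem (hc i) _]

/-- Taking mean values is the adjoint of interpolation, which is why replacing `g` by `g_h` causes
no error in the linear dual term. -/
theorem inner_interp (f : L2 Ω ℝ) (q : Fin N → ℝ) :
    ⟪f, G.interp q⟫ = G.inner (G.discretize f) q := by
  rw [interp, inner_sum, SquareGrid.inner]
  refine Finset.sum_congr rfl fun i _ => ?_
  have h := G.side_pos i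
  rw [real_inner_comm, L2.inner_indicatorConstLp_eq_inner_setIntegral ℝ, discretize,
    Measure.restrict_restrict (isOpen_square _ _).measurableSet,
    Set.inter_eq_left.2 (G.subset i)]
  simp only [RCLike.inner_apply, conj_trivial, cell]
  field_simp

theorem discretize_interp (q : Fin N → ℝ) : G.discretize (G.interp q) = q := by
  ext i
  have h : ∫ x in G.cell i, G.interp q x = ∫ _x in G.cell i, q i := by
    refine setIntegral_congr_ae (G.measurableSet_cell i) ?_
    have h1 := (ae_restrict_iff' (G.measurableSet_cell i)).1
      (ae_restrict_of_ae_restrict_of_subset (G.subset i) (G.coeFn_interp q))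
    filter_upwards [h1] with x hx hi
    rw [hx hi, G.sum_indicator_of_mem q hi]
  have hpos := G.side_pos i
  rw [discretize, h, setIntegral_const, volume_cell, smul_eq_mul]
  field_simp

/-- Taking mean values does not increase the `L²` norm. -/
theorem inner_discretize_self_le (f : L2 Ω ℝ) :
    G.inner (G.discretize f) (G.discretize f) ≤ ‖f‖ ^ 2 := by
  -- Interpolated mean values form an orthogonal projection of `f`; the claim is Pythagoras.
  have h1 := G.inner_interp f (G.discretize f)
  have h2 := G.inner_interp (G.interp (G.discretize f)) (G.discretize f)
  rw [discretize_interp, real_inner_self_eq_norm_sq] at h2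
  have h3 := norm_sub_sq_real f (G.interp (G.discretize f))
  nlinarith [sq_nonneg ‖f - G.interp (G.discretize f)‖]

end SquareGrid

/-! ## The error estimate -/

section Main

variable {Ω : Set Pt} {m : ℕ} {g : L2 Ω ℝ} {α₁ α₂ β lam : ℝ} {r s : ℝ≥0∞}
  {T : L2 Ω (Vec m) →L[ℝ] L2 Ω ℝ} {S : Reg}

/-- The number `γ` treats together the cases where the regularization makes sense on all of `L²`: `γ
= β` for `S = Id` and `γ = 0` for `β = 0`. If the variation is infinite, `lam > 0` makes the energy
infinite despite `0 * ∞ = 0`. -/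
theorem IsPrimalSolution.half_bNormSq_le_of_notMem (hΩ : IsOpen Ω) (hbdd : Bornology.IsBounded Ω)
    (hLip : HasLipschitzBoundary Ω) (hrs : r⁻¹ + s⁻¹ = 1) (hα₁ : 0 ≤ α₁) (hlam : 0 < lam)
    {u : H1 Ω m} (hu : IsPrimalSolution g α₁ α₂ β lam r T S u) {γ : ℝ} (hγ0 : 0 ≤ γ)
    (hγ : ∀ w : H1 Ω m, β * sNormSq S w = γ * ‖incl Ω m w‖ ^ 2)
    (hγ₁ : ∀ v : L2 Ω (Vec m),
      ENNReal.ofReal β * sNormSqExt S v = ENNReal.ofReal (γ * ‖v‖ ^ 2))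
    (hγ₂ : ∀ v : L2 Ω (Vec m),
      ENNReal.ofReal (β / 2) * sNormSqExt S v = ENNReal.ofReal (γ / 2 * ‖v‖ ^ 2))
    {v : L2 Ω (Vec m)} (hv : ¬ ∃ w : H1 Ω m, incl Ω m w = v) :
    extEnergy g α₁ α₂ β lam r s T S v = ⊤ ∨ ∃ e b : ℝ,
      extEnergy g α₁ α₂ β lam r s T S v = e ∧ bNormSq α₂ β T S (v - incl Ω m u) = b ∧
      1 / 2 * b ≤ e - primalEnergy g α₁ α₂ β lam r T S u := by
  have hfin := isFiniteMeasure_restrict_of_isBounded hbdd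
  rw [extEnergy, dif_neg hv, bNormSq, hγ₁, hγ₂]
  by_cases htv : totalVariation s v = ⊤
  · left
    rw [htv, ENNReal.mul_top (ENNReal.ofReal_pos.2 hlam).ne', add_top, EReal.coe_ennreal_top,
      EReal.coe_add_top]
  · right
    refine ⟨_, _, ?_, ?_,
      hu.half_sq_le_of_totalVariation_ne_top hΩ hbdd hLip hrs hα₁ hlam.le hγ htv⟩
    · rw [add_assoc _ (γ / 2 * ‖v‖ ^ 2), EReal.coe_add _ (γ / 2 * ‖v‖ ^ 2 + _)]
      congr 1
      conv_lhs => rw [← ENNReal.ofReal_toReal htv]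
      rw [← ENNReal.ofReal_mul hlam.le, ← ENNReal.ofReal_add (by positivity) (by positivity),
        EReal.coe_ennreal_ofReal, max_eq_left (by positivity)]
    · rw [EReal.coe_ennreal_ofReal, max_eq_left (by positivity), EReal.coe_add]

/-- The growth of the extended energy away from the solution of the primal problem. -/
theorem IsPrimalSolution.half_bNormSq_le (hΩ : IsOpen Ω) (hbdd : Bornology.IsBounded Ω)
    (hLip : HasLipschitzBoundary Ω) (hrs : r⁻¹ + s⁻¹ = 1) (hα₁ : 0 ≤ α₁) (hβ : 0 ≤ β)
    (hlam : 0 < lam) {u : H1 Ω m} (hu : IsPrimalSolution g α₁ α₂ β lam r T S u)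
    (v : L2 Ω (Vec m)) :
    extEnergy g α₁ α₂ β lam r s T S v = ⊤ ∨ ∃ e b : ℝ,
      extEnergy g α₁ α₂ β lam r s T S v = e ∧ bNormSq α₂ β T S (v - incl Ω m u) = b ∧
      1 / 2 * b ≤ e - primalEnergy g α₁ α₂ β lam r T S u := by
  have hfin := isFiniteMeasure_restrict_of_isBounded hbdd
  have hr : Fact (1 ≤ r) := ⟨one_le_left_of_inv_add_inv hrs⟩
  by_cases hv : ∃ w : H1 Ω m, incl Ω m w = v
  · obtain ⟨w, rfl⟩ := hv
    right
    refine ⟨_, _, extEnergy_incl hΩ w, ?_, hu.half_sq_le hα₁ hlam.le w⟩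
    rw [← map_sub, bNormSq_incl hΩ hβ]
  · rcases eq_or_lt_of_le hβ with rfl | hβ
    · refine hu.half_bNormSq_le_of_notMem hΩ hbdd hLip hrs hα₁ hlam (γ := 0) le_rfl ?_ ?_ ?_ hv <;>
        simp
    · cases S with
      | id =>
        refine hu.half_bNormSq_le_of_notMem hΩ hbdd hLip hrs hα₁ hlam hβ.le (fun _ => rfl) ?_ ?_ hv
        · exact fun v => (ENNReal.ofReal_mul hβ.le).symm
        · exact fun v => (ENNReal.ofReal_mul (half_pos hβ).le).symm
      | grad =>
        -- A gradient regularization with positive weight is infinite off `H¹`.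
        left
        rw [extEnergy, dif_neg hv, sNormSqExt, dif_neg hv,
          ENNReal.mul_top (ENNReal.ofReal_pos.2 (half_pos hβ)).ne', top_add,
          EReal.coe_ennreal_top, EReal.coe_add_top]

variable {N : ℕ} {G : SquareGrid Ω N} {Ths : (Fin N → ℝ) →ₗ[ℝ] (Fin N → Vec m)}
  {gradhs : (Fin N → Mat m) →ₗ[ℝ] (Fin N → Vec m)}
  {Bhi : (Fin N → Vec m) →ₗ[ℝ] (Fin N → Vec m)} {p₁ : Fin N → ℝ} {p₂ : Fin N → Mat m}

/-- The pair `(0, 0)` is feasible with a finite value, so a maximizer cannot have the value `⊥`. -/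
theorem feasible_of_isMax_discDual [Fact (1 ≤ s)] (hα₁ : 0 ≤ α₁) (hlam : 0 ≤ lam)
    (hp : ∀ q₁ q₂, discDual G g α₁ α₂ lam s Ths gradhs Bhi q₁ q₂
      ≤ discDual G g α₁ α₂ lam s Ths gradhs Bhi p₁ p₂) :
    (∀ i, |p₁ i| ≤ α₁) ∧ ∀ i, frob s (p₂ i) ≤ lam := by
  by_contra hcon
  have h := hp 0 0
  rw [discDual, discDual, if_neg hcon, if_pos ⟨fun i => by simpa using hα₁, fun i => by
    simpa [frob_zero] using hlam⟩] at h
  exact EReal.coe_ne_bot _ (le_bot_iff.1 h)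

/-- The consistency error of the dual energy, from weak duality for the interpolated solution. -/
theorem le_dualConsistency (hbdd : Bornology.IsBounded Ω) (hrs : r⁻¹ + s⁻¹ = 1) (hα₁ : 0 ≤ α₁)
    (hα₂ : 0 ≤ α₂) (hβ : 0 ≤ β) (hlam : 0 ≤ lam) (hB : BInvertible α₂ β T S)
    (hp₁ : ∀ i, |p₁ i| ≤ α₁) (hp₂ : ∀ i, frob s (p₂ i) ≤ lam) (u : H1 Ω m) :
    ((α₂ / 2 * ‖g‖ ^ 2 - G.inner (G.discretize g) p₁ - primalEnergy g α₁ α₂ β lam r T S u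
      - 1 / 2 * discResidualSq G g α₂ Ths gradhs Bhi p₁ p₂ : ℝ) : EReal)
      ≤ dualConsistency G g α₂ β T S Ths gradhs Bhi p₁ p₂ := by
  have hfin := isFiniteMeasure_restrict_of_isBounded hbdd
  have hr : Fact (1 ≤ r) := ⟨one_le_left_of_inv_add_inv hrs⟩
  have hs : Fact (1 ≤ s) := ⟨one_le_left_of_inv_add_inv ((add_comm _ _).trans hrs)⟩
  have h := le_bInvNormSq_dualResidual (g := g) (r := r) hrs hα₂ hβ hB
    (G.interp_mem (P := fun y => |y| ≤ α₁) (by simpa using hα₁) hp₁)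
    (G.interp_mem (P := fun y => frob s y ≤ lam) (by simpa [frob_zero] using hlam) hp₂) u
  rw [G.inner_interp] at h
  have h2 := mul_le_mul_of_nonneg_left
    (EReal.sub_le_sub h (le_refl ((discResidualSq G g α₂ Ths gradhs Bhi p₁ p₂ : ℝ) : EReal)))
    (show (0 : EReal) ≤ ((1 / 2 : ℝ) : EReal) from EReal.coe_nonneg.2 (by norm_num))
  refine le_trans (le_of_eq ?_) h2
  rw [← EReal.coe_sub, ← EReal.coe_mul]
  congr 1
  ring

end Main

end PDGap

end

open PDGap

/-- The constant is `c = 0`: the estimate holds without the data error, since `g_h` consists of mean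
values. Hence `⟨g, I_h p⟩ = ⟨g_h, p⟩` and, by Jensen's inequality, `‖g_h‖ ≤ ‖g‖`, so that replacing
`g` by `g_h` in the dual energy only contributes a term of favorable sign. -/
theorem proposition1 (Ω : Set Pt) (hΩ : IsOpen Ω) (hbdd : Bornology.IsBounded Ω)
    (hLip : HasLipschitzBoundary Ω) (g : L2 Ω ℝ) (α₁ α₂ : ℝ) (hα₁ : 0 ≤ α₁) (hα₂ : 0 ≤ α₂) :
    ∃ c : ℝ, 0 ≤ c ∧
      ∀ (m : ℕ) (T : L2 Ω (Vec m) →L[ℝ] L2 Ω ℝ) (S : Reg) (β lam : ℝ) (r s : ℝ≥0∞),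
        0 ≤ β → 0 < lam → r⁻¹ + s⁻¹ = 1 → BInvertible α₂ β T S →
      ∀ u : H1 Ω m, IsPrimalSolution g α₁ α₂ β lam r T S u →
      ∀ (N : ℕ) (G : SquareGrid Ω N)
        (Th : (Fin N → Vec m) →ₗ[ℝ] (Fin N → ℝ))
        (Ths : (Fin N → ℝ) →ₗ[ℝ] (Fin N → Vec m))
        (gradh : (Fin N → Vec m) →ₗ[ℝ] (Fin N → Mat m))
        (gradhs : (Fin N → Mat m) →ₗ[ℝ] (Fin N → Vec m))
        (Bhi : (Fin N → Vec m) →ₗ[ℝ] (Fin N → Vec m))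
        (uh : Fin N → Vec m) (ph₁ : Fin N → ℝ) (ph₂ : Fin N → Mat m),
        (∀ vh, discEnergy G g α₁ α₂ β lam r S Th gradh uh
          ≤ discEnergy G g α₁ α₂ β lam r S Th gradh vh) →
        (∀ qh₁ qh₂, discDual G g α₁ α₂ lam s Ths gradhs Bhi qh₁ qh₂
          ≤ discDual G g α₁ α₂ lam s Ths gradhs Bhi ph₁ ph₂) →
      ∀ (vh : Fin N → Vec m) (qh₁ : Fin N → ℝ) (qh₂ : Fin N → Mat m),
        ((1 / 2 : ℝ) : EReal) * bNormSq α₂ β T S (G.interp uh - incl Ω m u)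
          ≤ gapError G g α₁ α₂ β lam r s S Th Ths gradh gradhs Bhi vh qh₁ qh₂
            + ((c * ‖G.interp (G.discretize g) - g‖ : ℝ) : EReal)
            + primalConsistency G g α₁ α₂ β lam r s T S Th gradh uh
            + dualConsistency G g α₂ β T S Ths gradhs Bhi ph₁ ph₂ := by
  refine ⟨0, le_rfl, ?_⟩
  intro m T S β lam r s hβ hlam hrs hB u hu N G Th Ths gradh gradhs Bhi uh ph₁ ph₂ huh hph vh qh₁ qh₂
  have hs : Fact (1 ≤ s) := ⟨one_le_left_of_inv_add_inv ((add_comm _ _).trans hrs)⟩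
  have hfeas := feasible_of_isMax_discDual hα₁ hlam.le hph
  have hQ := le_dualConsistency (g := g) (r := r) (G := G) (Ths := Ths) (gradhs := gradhs) (Bhi := Bhi) hbdd hrs
    hα₁ hα₂ hβ hlam.le hB hfeas.1 hfeas.2 u
  -- Optimality of both discrete solutions makes their gap the smallest one; the bound also covers
  -- infeasible `qh₁`, `qh₂`, where `η_h` is `⊤`.
  have hgap := EReal.sub_le_sub (EReal.coe_le_coe_iff.2 (huh vh)) (hph qh₁ qh₂)
  rw [discDual.eq_def (q₁ := ph₁), if_pos hfeas, ← EReal.coe_sub] at hgap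
  have hsum := add_le_add hgap
    (le_refl ((0 * ‖G.interp (G.discretize g) - g‖ : ℝ) : EReal))
  rw [← EReal.coe_add] at hsum
  rcases hu.half_bNormSq_le (s := s) hΩ hbdd hLip hrs hα₁ hβ hlam (G.interp uh) with
    htop | ⟨e, b, he, hb, hle⟩
  -- As `⊤ + ⊥ = ⊥` in `EReal`, the other summands must be shown to differ from `⊥`; each has a real
  -- lower bound.
  · have h1 : primalConsistency G g α₁ α₂ β lam r s T S Th gradh uh = ⊤ := by
      rw [primalConsistency, htop, EReal.top_sub_coe]
    rw [gapError, h1, EReal.add_top_of_ne_bot (ne_bot_of_le_ne_bot (EReal.coe_ne_bot _) hsum),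
      EReal.top_add_of_ne_bot (ne_bot_of_le_ne_bot (EReal.coe_ne_bot _) hQ)]
    exact le_top
  · refine le_trans ?_ (add_le_add (add_le_add hsum
      (le_refl (primalConsistency G g α₁ α₂ β lam r s T S Th gradh uh))) hQ)
    rw [hb, primalConsistency, he, ← EReal.coe_sub, ← EReal.coe_mul, ← EReal.coe_add,
      ← EReal.coe_add]
    refine EReal.coe_le_coe_iff.2 ?_
    -- This is the sign of `(α₂/2)(‖g_h‖² - ‖g‖²)`, the only trace of the data discretization.
    have h1 := mul_le_mul_of_nonneg_left (G.inner_discretize_self_le g) hα₂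
    linarith
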